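/- Let $m\ge 2$ be an integer and let $\rho_n\in(-1,1)\setminus\{0\}$, $n\ge 2$. For each $n\ge 2$ let $(X^{(n)}_{i1},X^{(n)}_{i2})$, $1\le i\le m$, be independent random vectors, each with the law of $(Z,\rho_n Z+\sqrt{1-\rho_n^2}\,W)$, where $Z,W$ are independent standard normal variables, and let $H_n$ be the joint distribution function of the bivariate chi-square vector $$\zeta^{(n)}_1=\sum_{i=1}^m \bigl(X^{(n)}_{i1}\bigr)^2,\qquad \zeta^{(n)}_2=\sum_{i=1}^m \bigl(X^{(n)}_{i2}\bigr)^2 .$$ Put $a_n=2$, $b_n=2\ln n+(m-2)\ln\ln n-2\ln\Gamma(m/2)$ and $t_n(x)=a_nx+b_n$ for $n\ge 2$, and assume that the Hüsler–Reiss condition $$\lim_{n\to\infty}\,2\,\frac{b_n}{a_n}\,(1-\rho_n^2)=\lambda$$ holds for some $\lambda\in(0,\infty)$. Then for every $n\ge2$ the distribution function $(x,y)\mapsto \bigl(H_n(t_n(x),t_n(y))\bigr)^n$ on $\mathbb R^2$ (that of the componentwise maximum of $n$ independent copies of $\bigl((\zeta^{(n)}_1-b_n)/a_n,(\zeta^{(n)}_2-b_n)/a_n\bigr)$)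 has a probability density function $\hat h_n$ that is continuous on the open set $\{(x,y): t_n(x)>0,\ t_n(y)>0\}$, and for any such choice of $\hat h_n$, $n\ge 2$, and all $x,y\in\mathbb R$, $$\lim_{n\to\infty}\hat h_n(x,y)=h_\lambda(x,y),$$ where $$h_\lambda(x,y)=e^{-x}H_\lambda(x,y)\left(\frac1{\sqrt\lambda}\,\varphi\Bigl(\frac{\sqrt\lambda}2+\frac{y-x}{\sqrt\lambda}\Bigr)+e^{-y}\,\Phi\Bigl(\frac{\sqrt\lambda}2+\frac{y-x}{\sqrt\lambda}\Bigr)\Phi\Bigl(\frac{\sqrt\lambda}2+\frac{x-y}{\sqrt\lambda}\Bigr)\right)$$ is the density of the Hüsler–Reiss distribution function $$H_\lambda(x,y)=\exp\left(-e^{-x}\,\Phi\Bigl(\frac{\sqrt\lambda}2+\frac{y-x}{\sqrt\lambda}\Bigr)-e^{-y}\,\Phi\Bigl(\frac{\sqrt\lambda}2+\frac{x-y}{\sqrt\lambda}\Bigr)\right),$$ and $\Phi$, $\varphi$ are the standard normal distribution function and density. -/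

import Mathlib

open MeasureTheory ProbabilityTheory Filter Topology Set

noncomputable section

/-- The law of `(Z, r Z + √(1 - r²) W)` with `Z`, `W` independent standard Gaussian variables:
the bivariate Gaussian law with standard margins and correlation `r`. -/
def gaussianPairLaw (r : ℝ) : Measure (ℝ × ℝ) :=
  ((gaussianReal 0 1).prod (gaussianReal 0 1)).map
    (fun p => (p.1, r * p.1 + √(1 - r ^ 2) * p.2))

/-- First component `∑ i, X_{i1} ^ 2` of the bivariate chi-square vector. -/
def chiSqFst {Ω : Type*} {m : ℕ} (X : Fin m → Ω → ℝ × ℝ) (ω : Ω) : ℝ :=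
  ∑ i, (X i ω).1 ^ 2

/-- Second component `∑ i, X_{i2} ^ 2` of the bivariate chi-square vector. -/
def chiSqSnd {Ω : Type*} {m : ℕ} (X : Fin m → Ω → ℝ × ℝ) (ω : Ω) : ℝ :=
  ∑ i, (X i ω).2 ^ 2

/-- Joint distribution function of a random vector `(ζ₁, ζ₂)`. -/
def jointCDF {Ω : Type*} [MeasurableSpace Ω] (P : Measure Ω) (ζ₁ ζ₂ : Ω → ℝ) (u v : ℝ) : ℝ :=
  P.real {ω | ζ₁ ω ≤ u ∧ ζ₂ ω ≤ v}

/-- The scaling constants `a_n = 2`. -/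
def normA (_n : ℕ) : ℝ := 2

/-- The centring constants `b_n = 2 ln n + (m - 2) ln (ln n) - 2 ln Γ(m / 2)` (used for `n ≥ 2`). -/
def normB (m n : ℕ) : ℝ :=
  2 * Real.log n + ((m : ℝ) - 2) * Real.log (Real.log n) - 2 * Real.log (Real.Gamma ((m : ℝ) / 2))

/-- `t_n(x) = a_n x + b_n`. -/
def normT (m n : ℕ) (x : ℝ) : ℝ := normA n * x + normB m n

/-- `f` is a probability density function of the bivariate distribution function `F`. -/
structure IsPDFOf (F f : ℝ → ℝ → ℝ) : Prop where
  measurable : Measurable (fun z : ℝ × ℝ => f z.1 z.2)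
  nonneg : ∀ x y, 0 ≤ f x y
  lintegral_eq : ∀ x y,
    ∫⁻ z in Iic x ×ˢ Iic y, ENNReal.ofReal (f z.1 z.2) = ENNReal.ofReal (F x y)

/-- The set of `(x, y)` whose image `(t_n(x), t_n(y))` lies in the open positive quadrant, the
interior of the support of the chi-square vector. -/
def posRegion (m n : ℕ) : Set (ℝ × ℝ) := {z | 0 < normT m n z.1 ∧ 0 < normT m n z.2}

/-- The standard Gaussian distribution function. -/
def stdPhi (x : ℝ) : ℝ := cdf (gaussianReal 0 1) x

/-- The standard Gaussian density. -/
def stdphi (x : ℝ) : ℝ := gaussianPDFReal 0 1 x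

/-- The bivariate Hüsler–Reiss distribution function `H_λ`. -/
def huslerReissCDF (l x y : ℝ) : ℝ :=
  Real.exp (-Real.exp (-x) * stdPhi (√l / 2 + (y - x) / √l)
    - Real.exp (-y) * stdPhi (√l / 2 + (x - y) / √l))

/-- The density `h_λ` of the Hüsler–Reiss distribution. -/
def huslerReissPDF (l x y : ℝ) : ℝ :=
  Real.exp (-x) * huslerReissCDF l x y *
    (1 / √l * stdphi (√l / 2 + (y - x) / √l)
      + Real.exp (-y) * stdPhi (√l / 2 + (y - x) / √l) * stdPhi (√l / 2 + (x - y) / √l))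

end

/-!
Write `m = j + 2` and `s² = 1 - ρ_n²`. The proof rests on an explicit density of the bivariate
chi-square vector, `f(u, v) = g(u) k(u, v)` on the open quadrant, where `g` is the chi-square
density and `k(u, ·)` is a scaled noncentral chi-square density. Given `X_{·1} = z`, the second
component is `|ρ z + s W|²` with `W` standard Gaussian; rotating `z` onto the first axis
(`lintegral_shift_rotate`) and passing to polar coordinates in the half plane spanned by the first
axis and the length of the remaining coordinates (`lintegral_shifted`) expresses `k` through the
integral `besselInt j κ = ∫₀^π e^{κ cos θ} (sin θ) ^ j dθ` at `κ = ρ √u √v / s²`. The same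
half-plane computation without shift gives the law of the norm of a Gaussian vector by induction on
the dimension (`hasRadialLaw`). Since `m ≥ 2`, `f` is the restriction of a continuous function on
the whole plane, and it is symmetric in `u` and `v`.

The distribution function is therefore the `C¹` function `∫₀^u ∫₀^v f`, its powers have continuous
densities by the fundamental theorem of calculus (`isPDFOf_scaledPowDensity`), and a density that
is continuous on an open set is determined there (`IsPDFOf.eqOn`). This reduces the claim to the
limit of `4 (n H^{n-1} f + n (n-1) H^{n-2} ∂₁H ∂₂H)` at `(t_n(x), t_n(y))`.

* `2 n g(t_n(x)) → e^{-x}` by the choice of the centring constants.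
* `2 k(t_n(x), t_n(y))` converges to a normal density with variance `λ`: the exponent is
  `-(√v - |ρ| √u)² / (2 s²)` up to `e^{-κ} besselInt j κ`, whose power decay is Laplace's method
  (`tendsto_besselInt`). The conditional distribution functions converge by Scheffé's lemma
  (`tendsto_chiSqCondCDF`), which gives the limits of `n ∂₁H` and `n ∂₂H`.
* `n (1 - H)` is the sum of the marginal exceedance probability of `ζ₁` and of an integral of the
  conditional distribution function against the tail of `ζ₂`. Dominated convergence and
  `integral_Ioi_exp_mul_stdPhi` identify its limit with `-log H_λ(x, y)`, whence `H^n → H_λ`.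
-/

/-! ### Special functions and densities -/

/-- The half-line Gaussian moment `∫₀^∞ x ^ j e^{-x²/2} dx`. -/
noncomputable def gaussMoment (j : ℕ) : ℝ := ∫ x in Ioi (0 : ℝ), x ^ j * Real.exp (-x ^ 2 / 2)

/-- The integral `∫₀^π e^{κ cos θ} (sin θ) ^ j dθ`, a modified Bessel function of order `j / 2`
up to elementary factors. -/
noncomputable def besselInt (j : ℕ) (κ : ℝ) : ℝ :=
  ∫ θ in (0 : ℝ)..Real.pi, Real.exp (κ * Real.cos θ) * Real.sin θ ^ j

/-- The density on `(0, ∞)` of the norm of a standard Gaussian vector in dimension `j + 1`. -/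
noncomputable def normDensity (j : ℕ) (x : ℝ) : ℝ :=
  x ^ j * Real.exp (-x ^ 2 / 2) / gaussMoment j

/-- The density on `(0, ∞)` of the chi-square law with `j + 2` degrees of freedom. The junk value
`√u = 0` for `u < 0` makes it a continuous function on all of `ℝ`. -/
noncomputable def chiSqDensity (j : ℕ) (u : ℝ) : ℝ :=
  √u ^ j * Real.exp (-u / 2) / (2 * gaussMoment (j + 1))

/-- The conditional density on `(0, ∞)` of the second component of the bivariate chi-square vector
with `j + 2` degrees of freedom and correlation `r`, given that the first one is `u`. -/
noncomputable def condDensity (j : ℕ) (r u v : ℝ) : ℝ :=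
  √v ^ j / (2 * √(2 * Real.pi) * gaussMoment j * √(1 - r ^ 2) ^ (j + 2)) *
    Real.exp (-(v + r ^ 2 * u) / (2 * (1 - r ^ 2))) *
    besselInt j (r * √u * √v / (1 - r ^ 2))

/-- The joint density on the open quadrant of the bivariate chi-square vector. -/
noncomputable def jointDensity (j : ℕ) (r u v : ℝ) : ℝ := chiSqDensity j u * condDensity j r u v

lemma integrableOn_pow_mul_exp_neg_sq (j : ℕ) :
    IntegrableOn (fun x : ℝ => x ^ j * Real.exp (-x ^ 2 / 2)) (Ioi 0) := by
  have h := integrableOn_rpow_mul_exp_neg_mul_rpow (p := 2) (s := j) (b := 1 / 2)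
    (by have : (0:ℝ) ≤ j := by positivity
        linarith) (by norm_num) (by norm_num)
  refine h.congr_fun (fun x _ => ?_) measurableSet_Ioi
  simp only [Real.rpow_natCast, Real.rpow_ofNat]
  ring_nf

lemma gaussMoment_pos (j : ℕ) : 0 < gaussMoment j := by
  unfold gaussMoment
  rw [setIntegral_pos_iff_support_of_nonneg_ae]
  · have : Function.support (fun x : ℝ => x ^ j * Real.exp (-x ^ 2 / 2)) ∩ Ioi 0 = Ioi 0 := by
      apply inter_eq_right.2
      intro x hx
      have hx' : (0 : ℝ) < x := hx
      simp only [Function.mem_support]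
      positivity
    rw [this]; simp
  · filter_upwards [ae_restrict_mem measurableSet_Ioi] with x hx
    have hx' : (0 : ℝ) < x := hx
    simp only [Pi.zero_apply]
    positivity
  · exact integrableOn_pow_mul_exp_neg_sq j

lemma gaussMoment_succ (j : ℕ) :
    2 * gaussMoment (j + 1) = 2 * (2 : ℝ) ^ ((j : ℝ) / 2) * Real.Gamma (((j : ℝ) + 2) / 2) := by
  have h := integral_rpow_mul_exp_neg_mul_rpow (p := 2) (q := (j : ℝ) + 1) (b := 1 / 2)
    (by norm_num) (by have : (0:ℝ) ≤ j := by positivity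
                      linarith) (by norm_num)
  have h2 : gaussMoment (j + 1) =
      ∫ x in Ioi (0 : ℝ), x ^ ((j : ℝ) + 1) * Real.exp (-(1 / 2) * x ^ (2 : ℝ)) := by
    refine setIntegral_congr_fun measurableSet_Ioi (fun x _ => ?_)
    rw [show (j : ℝ) + 1 = ((j + 1 : ℕ) : ℝ) by push_cast; ring, Real.rpow_natCast,
      Real.rpow_ofNat]
    ring_nf
  rw [h2, h, one_div, Real.inv_rpow (by norm_num), ← Real.rpow_neg (by norm_num),
    show -(-((j : ℝ) + 1 + 1) / 2) = (j : ℝ) / 2 + 1 by ring, Real.rpow_add (by norm_num),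
    Real.rpow_one, show (j : ℝ) + 1 + 1 = j + 2 by ring]
  ring

lemma besselInt_nonneg (j : ℕ) (κ : ℝ) : 0 ≤ besselInt j κ := by
  refine intervalIntegral.integral_nonneg Real.pi_pos.le (fun θ hθ => ?_)
  have := Real.sin_nonneg_of_nonneg_of_le_pi hθ.1 hθ.2
  positivity

lemma besselInt_neg (j : ℕ) (κ : ℝ) : besselInt j (-κ) = besselInt j κ := by
  unfold besselInt
  have := intervalIntegral.integral_comp_sub_left (a := 0) (b := Real.pi)
    (fun θ => Real.exp (κ * Real.cos θ) * Real.sin θ ^ j) Real.pi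
  simp only [sub_self, sub_zero] at this
  rw [← this]
  refine intervalIntegral.integral_congr (fun θ _ => ?_)
  simp [Real.cos_pi_sub, Real.sin_pi_sub]

lemma besselInt_abs (j : ℕ) (κ : ℝ) : besselInt j |κ| = besselInt j κ := by
  rcases abs_choice κ with h | h <;> simp [h, besselInt_neg]

lemma continuous_besselInt (j : ℕ) : Continuous (besselInt j) :=
  intervalIntegral.continuous_parametric_intervalIntegral_of_continuous'
    (by fun_prop) 0 Real.pi

lemma continuous_chiSqDensity (j : ℕ) : Continuous (chiSqDensity j) := by
  unfold chiSqDensity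
  fun_prop

lemma continuous_jointDensity (j : ℕ) (r : ℝ) :
    Continuous fun z : ℝ × ℝ => jointDensity j r z.1 z.2 := by
  have := continuous_besselInt j
  unfold jointDensity chiSqDensity condDensity
  fun_prop

lemma continuous_condDensity (j : ℕ) (r : ℝ) :
    Continuous fun z : ℝ × ℝ => condDensity j r z.1 z.2 := by
  have := continuous_besselInt j
  unfold condDensity
  fun_prop

lemma chiSqDensity_nonneg (j : ℕ) (u : ℝ) : 0 ≤ chiSqDensity j u := by
  have := gaussMoment_pos (j + 1)
  unfold chiSqDensity
  positivity

lemma condDensity_nonneg (j : ℕ) (r u v : ℝ) : 0 ≤ condDensity j r u v := by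
  have := gaussMoment_pos j
  have := besselInt_nonneg j (r * √u * √v / (1 - r ^ 2))
  unfold condDensity
  positivity

lemma jointDensity_nonneg (j : ℕ) (r u v : ℝ) : 0 ≤ jointDensity j r u v :=
  mul_nonneg (chiSqDensity_nonneg j u) (condDensity_nonneg j r u v)

lemma jointDensity_comm (j : ℕ) {r : ℝ} (hr : 0 < 1 - r ^ 2) (u v : ℝ) :
    jointDensity j r u v = jointDensity j r v u := by
  have h (u v : ℝ) : jointDensity j r u v =
      √u ^ j * √v ^ j / ((2 * gaussMoment (j + 1)) *
        (2 * √(2 * Real.pi) * gaussMoment j * √(1 - r ^ 2) ^ (j + 2))) *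
      Real.exp (-(u + v) / (2 * (1 - r ^ 2))) * besselInt j (r * √u * √v / (1 - r ^ 2)) := by
    unfold jointDensity chiSqDensity condDensity
    rw [show -(u + v) / (2 * (1 - r ^ 2)) = -u / 2 + -(v + r ^ 2 * u) / (2 * (1 - r ^ 2)) by
      field_simp; ring, Real.exp_add]
    have := gaussMoment_pos (j + 1)
    have := gaussMoment_pos j
    field_simp
  rw [h, h, add_comm u v, mul_right_comm r (√u)]
  ring

/-! ### Changes of variables -/

lemma lintegral_comp_add_mul (a : ℝ) {s : ℝ} (hs : 0 < s) (f : ℝ → ENNReal) :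
    ∫⁻ x, ENNReal.ofReal s * f (a + s * x) = ∫⁻ x, f x := by
  have h := lintegral_image_eq_lintegral_abs_deriv_mul (s := univ) (f := fun x : ℝ => a + s * x)
    (f' := fun _ => s) MeasurableSet.univ
    (fun x _ => by simpa using ((hasDerivAt_id x).const_mul s).const_add a)
    (fun x _ y _ hxy => by simpa [hs.ne'] using hxy) f
  have him : (fun x : ℝ => a + s * x) '' univ = univ := by
    rw [image_univ, range_eq_univ]
    intro y
    exact ⟨(y - a) / s, by field_simp; ring⟩
  rw [him] at h
  simpa [abs_of_pos hs] using h.symm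

lemma setLIntegral_Ioi_comp_mul {s : ℝ} (hs : 0 < s) (f : ℝ → ENNReal) :
    ∫⁻ x in Ioi 0, ENNReal.ofReal s * f (s * x) = ∫⁻ x in Ioi 0, f x := by
  have h := lintegral_image_eq_lintegral_abs_deriv_mul (s := Ioi 0) (f := fun x : ℝ => s * x)
    (f' := fun _ => s) measurableSet_Ioi
    (fun x _ => by simpa using ((hasDerivAt_id x).const_mul s).hasDerivWithinAt)
    (fun x _ y _ hxy => by simpa [hs.ne'] using hxy) f
  have him : (fun x : ℝ => s * x) '' Ioi 0 = Ioi 0 := by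
    ext y
    simp only [mem_image, mem_Ioi]
    constructor
    · rintro ⟨x, hx, rfl⟩; positivity
    · intro hy; exact ⟨y / s, by positivity, by field_simp⟩
  rw [him] at h
  simpa [abs_of_pos hs] using h.symm

lemma setLIntegral_Ioi_comp_sq (f : ℝ → ENNReal) :
    ∫⁻ x in Ioi (0 : ℝ), ENNReal.ofReal (2 * x) * f (x ^ 2) = ∫⁻ x in Ioi 0, f x := by
  have h := lintegral_image_eq_lintegral_abs_deriv_mul (s := Ioi 0) (f := fun x : ℝ => x ^ 2)
    (f' := fun x => 2 * x) measurableSet_Ioi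
    (fun x _ => by simpa using (hasDerivAt_pow 2 x).hasDerivWithinAt)
    (fun x hx y hy hxy => (pow_left_inj₀ (le_of_lt hx) (le_of_lt hy) two_ne_zero).1 hxy) f
  have him : (fun x : ℝ => x ^ 2) '' Ioi 0 = Ioi 0 := by
    ext y
    simp only [mem_image, mem_Ioi]
    constructor
    · rintro ⟨x, hx, rfl⟩; positivity
    · intro hy; exact ⟨√y, by positivity, Real.sq_sqrt hy.le⟩
  rw [him] at h
  rw [h]
  refine setLIntegral_congr_fun measurableSet_Ioi (fun x hx => ?_)
  have hx' : (0 : ℝ) < x := hx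
  simp only [abs_of_pos (show (0 : ℝ) < 2 * x by positivity)]

/-- Polar coordinates on the upper half plane, for a function with a radial factor. -/
lemma lintegral_halfPlane_polar (F : ℝ → ENNReal) (hF : Measurable F) (D : ℝ → ℝ → ENNReal)
    (hD : Measurable (Function.uncurry D)) :
    ∫⁻ x, ∫⁻ y in Ioi 0, F (x ^ 2 + y ^ 2) * D x y =
      ∫⁻ t in Ioi 0, F (t ^ 2) * ∫⁻ θ in Ioo 0 Real.pi,
        ENNReal.ofReal t * D (t * Real.cos θ) (t * Real.sin θ) := by
  have hmeas : Measurable fun p : ℝ × ℝ => (Ioi (0 : ℝ)).indicator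
      (fun y => F (p.1 ^ 2 + y ^ 2) * D p.1 y) p.2 := by
    have : Measurable ((univ ×ˢ Ioi (0 : ℝ)).indicator
      (fun p : ℝ × ℝ => F (p.1 ^ 2 + p.2 ^ 2) * Function.uncurry D p)) :=
      Measurable.indicator (by fun_prop) (MeasurableSet.univ.prod measurableSet_Ioi)
    convert this using 2 with p
    simp [indicator, Function.uncurry]
  have h1 : ∫⁻ x, ∫⁻ y in Ioi 0, F (x ^ 2 + y ^ 2) * D x y =
      ∫⁻ p : ℝ × ℝ, (Ioi (0 : ℝ)).indicator (fun y => F (p.1 ^ 2 + y ^ 2) * D p.1 y) p.2 := by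
    rw [Measure.volume_eq_prod, lintegral_prod _ hmeas.aemeasurable]
    refine lintegral_congr fun x => ?_
    rw [← lintegral_indicator measurableSet_Ioi]
  rw [h1, ← lintegral_comp_polarCoord_symm, polarCoord_target, Measure.volume_eq_prod,
    ← Measure.prod_restrict, lintegral_prod]
  · refine setLIntegral_congr_fun measurableSet_Ioi (fun t ht => ?_)
    have ht' : (0 : ℝ) < t := ht
    simp only [polarCoord_symm_apply, smul_eq_mul]
    rw [← lintegral_const_mul, ← lintegral_indicator measurableSet_Ioo,
      ← lintegral_indicator measurableSet_Ioo]
    · refine lintegral_congr fun θ => ?_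
      have hsq : (t * Real.cos θ) ^ 2 + (t * Real.sin θ) ^ 2 = t ^ 2 := by
        rw [mul_pow, mul_pow, ← mul_add, Real.cos_sq_add_sin_sq, mul_one]
      by_cases h : θ ∈ Ioo 0 Real.pi
      · have h' : θ ∈ Ioo (-Real.pi) Real.pi := ⟨by linarith [h.1, Real.pi_pos], h.2⟩
        have hs : t * Real.sin θ ∈ Ioi (0 : ℝ) := mul_pos ht' (Real.sin_pos_of_mem_Ioo h)
        rw [indicator_of_mem h, indicator_of_mem h', indicator_of_mem hs, hsq]
        ring
      · rw [indicator_of_notMem h]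
        by_cases h' : θ ∈ Ioo (-Real.pi) Real.pi
        · have hs : t * Real.sin θ ∉ Ioi (0 : ℝ) := by
            have h0 : θ ≤ 0 := by
              by_contra hcon
              exact h ⟨not_le.1 hcon, h'.2⟩
            have := Real.sin_nonpos_of_nonpos_of_neg_pi_le h0 h'.1.le
            simp only [mem_Ioi, not_lt]
            exact mul_nonpos_of_nonneg_of_nonpos ht'.le this
          rw [indicator_of_mem h', indicator_of_notMem hs, mul_zero]
        · rw [indicator_of_notMem h']
    · have : Measurable fun θ : ℝ => Function.uncurry D (t * Real.cos θ, t * Real.sin θ) :=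
        hD.comp (by fun_prop)
      exact this.const_mul _
  · have hsymm : Measurable fun p : ℝ × ℝ => polarCoord.symm p := by
      simp only [polarCoord_symm_apply]
      fun_prop
    exact ((ENNReal.measurable_ofReal.comp measurable_fst).smul
      (hmeas.comp hsymm)).aemeasurable

/-! ### Radial laws of Gaussian vectors -/

/-- The density on `(0, ∞)` of the norm of `a e + s W`, where `W` is a standard Gaussian vector in
dimension `j + 2` and `e` is a unit vector. -/
noncomputable def shiftedNormDensity (j : ℕ) (a s t : ℝ) : ℝ :=
  t ^ (j + 1) / (√(2 * Real.pi) * gaussMoment j * s ^ (j + 2)) *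
    Real.exp (-(t ^ 2 + a ^ 2) / (2 * s ^ 2)) * besselInt j (a * t / s ^ 2)

/-- The law of the squared norm of a standard Gaussian vector in dimension `j + 1`, tested
against a nonnegative function. -/
def HasRadialLaw (j : ℕ) : Prop :=
  ∀ F : ℝ → ENNReal, Measurable F →
    ∫⁻ w, F (∑ i, w i ^ 2) ∂(Measure.pi fun _ : Fin (j + 1) => gaussianReal 0 1) =
      ∫⁻ x in Ioi 0, F (x ^ 2) * ENNReal.ofReal (normDensity j x)

lemma lintegral_gaussianReal (f : ℝ → ENNReal) (hf : Measurable f) :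
    ∫⁻ x, f x ∂(gaussianReal 0 1) =
      ∫⁻ x, f x * ENNReal.ofReal (Real.exp (-x ^ 2 / 2) / √(2 * Real.pi)) := by
  rw [gaussianReal_of_var_ne_zero _ one_ne_zero,
    lintegral_withDensity_eq_lintegral_mul _ (by fun_prop) hf]
  refine lintegral_congr fun x => ?_
  simp only [Pi.mul_apply, gaussianPDF, gaussianPDFReal]
  rw [mul_comm]
  congr 2
  simp
  ring

lemma continuous_normDensity (j : ℕ) : Continuous (normDensity j) := by
  unfold normDensity
  fun_prop

/-- The norm of a shifted and scaled Gaussian vector: its components along the shift and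
orthogonal to it are the Cartesian coordinates of a point of the upper half plane, whose radial
coordinate is the norm. -/
lemma lintegral_shifted (j : ℕ) (hj : HasRadialLaw j) (a : ℝ) {s : ℝ} (hs : 0 < s)
    (F : ℝ → ENNReal) (hF : Measurable F) :
    ∫⁻ w, F ((a + s * w 0) ^ 2 + s ^ 2 * ∑ i : Fin (j + 1), w i.succ ^ 2)
        ∂(Measure.pi fun _ : Fin (j + 2) => gaussianReal 0 1) =
      ∫⁻ t in Ioi 0, F (t ^ 2) * ENNReal.ofReal (shiftedNormDensity j a s t) := by
  have hsplit : ∫⁻ w, F ((a + s * w 0) ^ 2 + s ^ 2 * ∑ i : Fin (j + 1), w i.succ ^ 2)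
        ∂(Measure.pi fun _ : Fin (j + 2) => gaussianReal 0 1) =
      ∫⁻ x, ∫⁻ w, F ((a + s * x) ^ 2 + s ^ 2 * ∑ i, w i ^ 2)
        ∂(Measure.pi fun _ : Fin (j + 1) => gaussianReal 0 1) ∂(gaussianReal 0 1) := by
    have hm : Measurable fun p : ℝ × (Fin (j + 1) → ℝ) =>
        F ((a + s * p.1) ^ 2 + s ^ 2 * ∑ i, p.2 i ^ 2) := hF.comp (by fun_prop)
    rw [← lintegral_prod (fun p : ℝ × (Fin (j + 1) → ℝ) =>
        F ((a + s * p.1) ^ 2 + s ^ 2 * ∑ i, p.2 i ^ 2)) hm.aemeasurable]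
    have hmp := measurePreserving_piFinSuccAbove
      (fun _ : Fin (j + 2) => gaussianReal 0 1) 0
    rw [← hmp.lintegral_comp hm]
    refine lintegral_congr fun w => ?_
    simp [MeasurableEquiv.piFinSuccAbove, Fin.insertNthEquiv, Fin.tail]
  have hinner (x : ℝ) : ∫⁻ w, F ((a + s * x) ^ 2 + s ^ 2 * ∑ i, w i ^ 2)
        ∂(Measure.pi fun _ : Fin (j + 1) => gaussianReal 0 1) =
      ∫⁻ y in Ioi 0, F ((a + s * x) ^ 2 + y ^ 2) * ENNReal.ofReal (normDensity j (y / s) / s) := by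
    rw [hj (fun q => F ((a + s * x) ^ 2 + s ^ 2 * q)) (by fun_prop),
      ← setLIntegral_Ioi_comp_mul hs (fun y => F ((a + s * x) ^ 2 + y ^ 2) *
        ENNReal.ofReal (normDensity j (y / s) / s))]
    refine lintegral_congr fun y => ?_
    rw [mul_left_comm, ← ENNReal.ofReal_mul hs.le, mul_pow]
    congr 2
    field_simp
  have hnd := continuous_normDensity j
  have hmeas2 : Measurable fun x : ℝ => ∫⁻ y in Ioi 0, F ((a + s * x) ^ 2 + y ^ 2) *
      ENNReal.ofReal (normDensity j (y / s) / s) := by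
    apply Measurable.lintegral_prod_right (f := fun x y => F ((a + s * x) ^ 2 + y ^ 2) *
      ENNReal.ofReal (normDensity j (y / s) / s))
    unfold Function.uncurry
    have := hnd.measurable
    fun_prop
  rw [hsplit, lintegral_congr hinner, lintegral_gaussianReal _ hmeas2]
  have haff : ∫⁻ x, (∫⁻ y in Ioi 0, F ((a + s * x) ^ 2 + y ^ 2) *
        ENNReal.ofReal (normDensity j (y / s) / s)) *
        ENNReal.ofReal (Real.exp (-x ^ 2 / 2) / √(2 * Real.pi)) =
      ∫⁻ x, ∫⁻ y in Ioi 0, F (x ^ 2 + y ^ 2) *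
        (ENNReal.ofReal (Real.exp (-((x - a) / s) ^ 2 / 2) / √(2 * Real.pi) / s) *
          ENNReal.ofReal (normDensity j (y / s) / s)) := by
    refine Eq.trans (lintegral_congr fun x => ?_) (lintegral_comp_add_mul a hs _)
    have hm : Measurable fun y => F ((a + s * x) ^ 2 + y ^ 2) *
        ENNReal.ofReal (normDensity j (y / s) / s) := by
      have := hnd.measurable
      fun_prop
    rw [← lintegral_const_mul _ (by
      have := hnd.measurable
      fun_prop), ← lintegral_mul_const _ hm]
    refine lintegral_congr fun y => ?_
    have h1 : (a + s * x - a) / s = x := by field_simp; ring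
    rw [h1]
    have h2 : ENNReal.ofReal s * ENNReal.ofReal (Real.exp (-x ^ 2 / 2) / √(2 * Real.pi) / s) =
        ENNReal.ofReal (Real.exp (-x ^ 2 / 2) / √(2 * Real.pi)) := by
      rw [← ENNReal.ofReal_mul hs.le]
      congr 1
      field_simp
    rw [← h2]
    ring
  rw [haff, lintegral_halfPlane_polar F hF (fun x y =>
    ENNReal.ofReal (Real.exp (-((x - a) / s) ^ 2 / 2) / √(2 * Real.pi) / s) *
          ENNReal.ofReal (normDensity j (y / s) / s))]
  swap
  · have := hnd.measurable
    unfold Function.uncurry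
    fun_prop
  refine setLIntegral_congr_fun measurableSet_Ioi (fun t ht => ?_)
  have ht' : (0 : ℝ) < t := ht
  have hc := gaussMoment_pos j
  congr 1
  rw [shiftedNormDensity, besselInt, ← intervalIntegral.integral_const_mul,
    intervalIntegral.integral_of_le Real.pi_pos.le, integral_Ioc_eq_integral_Ioo,
    ofReal_integral_eq_lintegral_ofReal]
  · refine setLIntegral_congr_fun measurableSet_Ioo (fun θ hθ => ?_)
    have hsin := Real.sin_pos_of_mem_Ioo hθ
    rw [← ENNReal.ofReal_mul (by positivity), ← ENNReal.ofReal_mul (by positivity)]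
    congr 1
    unfold normDensity
    have hexp : Real.exp (-((t * Real.cos θ - a) / s) ^ 2 / 2) *
        Real.exp (-(t * Real.sin θ / s) ^ 2 / 2) =
        Real.exp (-(t ^ 2 + a ^ 2) / (2 * s ^ 2)) * Real.exp (a * t / s ^ 2 * Real.cos θ) := by
      rw [← Real.exp_add, ← Real.exp_add]
      congr 1
      have := Real.sin_sq θ
      field_simp
      rw [this]
      ring
    have : t * (Real.exp (-((t * Real.cos θ - a) / s) ^ 2 / 2) / √(2 * Real.pi) / s *
        ((t * Real.sin θ / s) ^ j * Real.exp (-(t * Real.sin θ / s) ^ 2 / 2) /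
          gaussMoment j / s)) =
        t * (t * Real.sin θ / s) ^ j / (√(2 * Real.pi) * s * gaussMoment j * s) *
          (Real.exp (-((t * Real.cos θ - a) / s) ^ 2 / 2) *
        Real.exp (-(t * Real.sin θ / s) ^ 2 / 2)) := by field_simp
    rw [this, hexp, div_pow, mul_pow]
    field_simp
    ring
  · exact (Continuous.integrableOn_Icc (by fun_prop)).mono_set Ioo_subset_Icc_self
  · filter_upwards [ae_restrict_mem measurableSet_Ioo] with θ hθ
    have hsin := Real.sin_pos_of_mem_Ioo hθ
    simp only [Pi.zero_apply]
    positivity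

lemma normDensity_nonneg {j : ℕ} {x : ℝ} (hx : 0 ≤ x) : 0 ≤ normDensity j x := by
  have := gaussMoment_pos j
  unfold normDensity
  positivity

lemma lintegral_normDensity (j : ℕ) :
    ∫⁻ x in Ioi 0, ENNReal.ofReal (normDensity j x) = 1 := by
  have hc := gaussMoment_pos j
  rw [← ofReal_integral_eq_lintegral_ofReal]
  · simp only [normDensity]
    rw [integral_div, ← gaussMoment, div_self hc.ne', ENNReal.ofReal_one]
  · exact (integrableOn_pow_mul_exp_neg_sq j).div_const _
  · filter_upwards [ae_restrict_mem measurableSet_Ioi] with x hx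
    exact normDensity_nonneg (le_of_lt hx)

/-- The constant in front of the norm density is forced by total mass `1`. -/
lemma hasRadialLaw_of_const {j : ℕ} {C : ℝ} (hC : 0 ≤ C)
    (h : ∀ F : ℝ → ENNReal, Measurable F →
      ∫⁻ w, F (∑ i, w i ^ 2) ∂(Measure.pi fun _ : Fin (j + 1) => gaussianReal 0 1) =
        ∫⁻ x in Ioi 0, F (x ^ 2) * ENNReal.ofReal (C * normDensity j x)) :
    HasRadialLaw j := by
  have h1 := h (fun _ => 1) measurable_const
  simp only [one_mul, ENNReal.ofReal_mul hC, lintegral_const, measure_univ, mul_one] at h1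
  rw [lintegral_const_mul _ (continuous_normDensity j).measurable.ennreal_ofReal,
    lintegral_normDensity, mul_one] at h1
  have hC1 : C = 1 := by
    have := congrArg ENNReal.toReal h1
    simpa [ENNReal.toReal_ofReal hC] using this.symm
  intro F hF
  simpa only [hC1, one_mul] using h F hF

lemma hasRadialLaw_zero : HasRadialLaw 0 := by
  have hc := gaussMoment_pos 0
  refine hasRadialLaw_of_const (C := 2 / √(2 * Real.pi) * gaussMoment 0) (by positivity)
    (fun F hF => ?_)
  have h0 : ∫⁻ w, F (∑ i, w i ^ 2) ∂(Measure.pi fun _ : Fin (0 + 1) => gaussianReal 0 1) =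
      ∫⁻ x, F (x ^ 2) ∂(gaussianReal 0 1) := by
    have := (measurePreserving_funUnique (gaussianReal 0 1) (Fin 1)).lintegral_comp
      (f := fun x => F (x ^ 2)) (by fun_prop)
    rw [← this]
    refine lintegral_congr fun w => ?_
    simp [MeasurableEquiv.funUnique]
  set G : ℝ → ENNReal := fun x =>
    F (x ^ 2) * ENNReal.ofReal (Real.exp (-x ^ 2 / 2) / √(2 * Real.pi)) with hG
  have hneg : ∫⁻ x in Iic 0, G x = ∫⁻ x in Ioi 0, G x := by
    have h1 := (Measure.measurePreserving_neg (volume : Measure ℝ)).setLIntegral_comp_preimage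
      (s := Iic 0) (f := G) measurableSet_Iic (by fun_prop)
    rw [← h1]
    have : (Neg.neg ⁻¹' Iic (0 : ℝ)) = Ici 0 := by ext; simp
    rw [this, setLIntegral_congr Ioi_ae_eq_Ici.symm]
    simp [hG]
  rw [h0, lintegral_gaussianReal _ (by fun_prop), ← lintegral_add_compl _ measurableSet_Iic,
    compl_Iic, hneg, ← two_mul, ← lintegral_const_mul _ (by fun_prop)]
  refine lintegral_congr fun x => ?_
  simp only [hG]
  rw [mul_left_comm, show (2 : ENNReal) = ENNReal.ofReal 2 by simp,
    ← ENNReal.ofReal_mul (by norm_num)]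
  congr 2
  unfold normDensity
  field_simp

/-- The norm density in every dimension, by adding one coordinate at a time. The half-plane
computation gives the shape of the density, and total mass `1` gives the constant. -/
lemma hasRadialLaw (j : ℕ) : HasRadialLaw j := by
  induction j with
  | zero => exact hasRadialLaw_zero
  | succ j ih =>
    have hc := gaussMoment_pos j
    have hc' := gaussMoment_pos (j + 1)
    refine hasRadialLaw_of_const
      (C := besselInt j 0 * gaussMoment (j + 1) / (√(2 * Real.pi) * gaussMoment j))
      (div_nonneg (mul_nonneg (besselInt_nonneg j 0) hc'.le) (by positivity)) (fun F hF => ?_)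
    have h := lintegral_shifted j ih 0 one_pos F hF
    convert h using 3 with w t
    · rw [Fin.sum_univ_succ]; simp
    · congr 1
      unfold shiftedNormDensity normDensity
      simp
      field_simp

/-! ### The law of the bivariate chi-square vector -/

/-- By rotation invariance the squared norm of a shifted Gaussian vector depends on the shift only
through its norm, so that the shift may be taken along the first axis. -/
lemma lintegral_shift_rotate (j : ℕ) (a : Fin (j + 2) → ℝ) (s : ℝ) (F : ℝ → ENNReal)
    (hF : Measurable F) :
    ∫⁻ w, F (∑ i, (a i + s * w i) ^ 2) ∂(Measure.pi fun _ : Fin (j + 2) => gaussianReal 0 1) =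
      ∫⁻ w, F ((√(∑ i, a i ^ 2) + s * w 0) ^ 2 + s ^ 2 * ∑ i : Fin (j + 1), w i.succ ^ 2)
        ∂(Measure.pi fun _ : Fin (j + 2) => gaussianReal 0 1) := by
  set a' : EuclideanSpace ℝ (Fin (j + 2)) := WithLp.toLp 2 a
  set b : EuclideanSpace ℝ (Fin (j + 2)) := EuclideanSpace.single 0 ‖a'‖ with hb
  have hnorm : ‖a'‖ = ‖b‖ := by simp [hb]
  set R : EuclideanSpace ℝ (Fin (j + 2)) ≃ₗᵢ[ℝ] EuclideanSpace ℝ (Fin (j + 2)) :=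
    (Submodule.span ℝ {a' - b})ᗮ.reflection
  have hR : R a' = b := Submodule.reflection_sub hnorm
  have htransfer (G : EuclideanSpace ℝ (Fin (j + 2)) → ENNReal) (hG : Measurable G) :
      ∫⁻ w, G (WithLp.toLp 2 w) ∂(Measure.pi fun _ : Fin (j + 2) => gaussianReal 0 1) =
        ∫⁻ x, G x ∂(stdGaussian (EuclideanSpace ℝ (Fin (j + 2)))) := by
    rw [← map_pi_eq_stdGaussian, lintegral_map hG (by fun_prop)]
  have hrot (G : EuclideanSpace ℝ (Fin (j + 2)) → ENNReal) (hG : Measurable G) :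
      ∫⁻ x, G (R x) ∂(stdGaussian (EuclideanSpace ℝ (Fin (j + 2)))) =
        ∫⁻ x, G x ∂(stdGaussian (EuclideanSpace ℝ (Fin (j + 2)))) := by
    conv_rhs => rw [← stdGaussian_map R]
    rw [lintegral_map hG (by fun_prop)]
  have h1 := htransfer (fun x => F (‖a' + s • x‖ ^ 2)) (by fun_prop)
  have h2 := htransfer (fun x => F (‖b + s • x‖ ^ 2)) (by fun_prop)
  have h3 := hrot (fun x => F (‖b + s • x‖ ^ 2)) (by fun_prop)
  have h4 (x : EuclideanSpace ℝ (Fin (j + 2))) : ‖b + s • R x‖ = ‖a' + s • x‖ := by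
    rw [← hR, ← map_smul, ← map_add, R.norm_map]
  simp only [h4] at h3
  have h5 : ‖a'‖ = √(∑ i, a i ^ 2) := by
    rw [EuclideanSpace.norm_eq]
    simp [a']
  rw [← h1, h2.symm] at h3
  simp only [EuclideanSpace.real_norm_sq_eq] at h3
  refine Eq.trans ?_ (h3.trans ?_)
  · simp [a']
  · refine lintegral_congr fun w => ?_
    rw [Fin.sum_univ_succ, Finset.mul_sum]
    simp [hb, h5, mul_pow]

/-- Passage from a density of the norm to a density of the squared norm. -/
lemma setLIntegral_Ioi_density {G : ℝ → ℝ} (hG : ∀ x, 0 < x → 0 ≤ G x) (F : ℝ → ENNReal) :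
    ∫⁻ x in Ioi (0 : ℝ), F (x ^ 2) * ENNReal.ofReal (2 * x * G (x ^ 2)) =
      ∫⁻ u in Ioi 0, F u * ENNReal.ofReal (G u) := by
  rw [← setLIntegral_Ioi_comp_sq fun u => F u * ENNReal.ofReal (G u)]
  refine setLIntegral_congr_fun measurableSet_Ioi (fun x hx => ?_)
  have hx' : (0 : ℝ) < x := hx
  have := hG (x ^ 2) (by positivity)
  rw [ENNReal.ofReal_mul (by positivity)]
  ring

lemma lintegral_sum_sq (j : ℕ) (F : ℝ → ENNReal) (hF : Measurable F) :
    ∫⁻ w, F (∑ i, w i ^ 2) ∂(Measure.pi fun _ : Fin (j + 2) => gaussianReal 0 1) =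
      ∫⁻ u in Ioi 0, F u * ENNReal.ofReal (chiSqDensity j u) := by
  rw [hasRadialLaw (j + 1) F hF, ← setLIntegral_Ioi_density fun x _ => chiSqDensity_nonneg j x]
  refine setLIntegral_congr_fun measurableSet_Ioi (fun x hx => ?_)
  have hx' : (0 : ℝ) < x := hx
  have hc := gaussMoment_pos (j + 1)
  congr 2
  unfold normDensity chiSqDensity
  rw [Real.sqrt_sq hx'.le]
  field_simp
  ring

lemma lintegral_sum_shift_sq (j : ℕ) {r : ℝ} (hr : 0 < 1 - r ^ 2) (z : Fin (j + 2) → ℝ)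
    (F : ℝ → ENNReal) (hF : Measurable F) :
    ∫⁻ w, F (∑ i, (r * z i + √(1 - r ^ 2) * w i) ^ 2)
        ∂(Measure.pi fun _ : Fin (j + 2) => gaussianReal 0 1) =
      ∫⁻ v in Ioi 0, F v * ENNReal.ofReal (condDensity j r (∑ i, z i ^ 2) v) := by
  have hs : 0 < √(1 - r ^ 2) := Real.sqrt_pos.2 hr
  rw [lintegral_shift_rotate j (fun i => r * z i) _ F hF,
    lintegral_shifted j (hasRadialLaw j) _ hs F hF,
    ← setLIntegral_Ioi_density fun x _ => condDensity_nonneg j r _ x]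
  refine setLIntegral_congr_fun measurableSet_Ioi (fun t ht => ?_)
  have ht' : (0 : ℝ) < t := ht
  have hc := gaussMoment_pos j
  congr 2
  have hq : √(∑ i, (r * z i) ^ 2) = |r| * √(∑ i, z i ^ 2) := by
    simp_rw [mul_pow]
    rw [← Finset.mul_sum, Real.sqrt_mul (sq_nonneg r), Real.sqrt_sq_eq_abs]
  have hz : 0 ≤ ∑ i, z i ^ 2 := Finset.sum_nonneg fun i _ => sq_nonneg _
  unfold shiftedNormDensity condDensity
  rw [hq, Real.sqrt_sq ht'.le, Real.sq_sqrt hr.le, mul_pow, sq_abs, Real.sq_sqrt hz,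
    ← besselInt_abs j (r * √(∑ i, z i ^ 2) * t / (1 - r ^ 2)),
    show |r * √(∑ i, z i ^ 2) * t / (1 - r ^ 2)| = |r| * √(∑ i, z i ^ 2) * t / (1 - r ^ 2) by
      rw [abs_div, abs_mul, abs_mul, abs_of_pos ht', abs_of_pos hr,
        abs_of_nonneg (Real.sqrt_nonneg _)]]
  field_simp
  ring

/-- The joint law of the bivariate chi-square vector, tested against a nonnegative function. -/
lemma lintegral_chiSq {Ω : Type*} [MeasurableSpace Ω] {P : Measure Ω} [IsProbabilityMeasure P]
    {j : ℕ} {r : ℝ} (hr : 0 < 1 - r ^ 2) {X : Fin (j + 2) → Ω → ℝ × ℝ}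
    (hlaw : ∀ i, HasLaw (X i) (gaussianPairLaw r) P) (hindep : iIndepFun X P)
    (F : ℝ × ℝ → ENNReal) (hF : Measurable F) :
    ∫⁻ ω, F (chiSqFst X ω, chiSqSnd X ω) ∂P =
      ∫⁻ u in Ioi 0, ∫⁻ v in Ioi 0, F (u, v) * ENNReal.ofReal (jointDensity j r u v) := by
  set T : ℝ × ℝ → ℝ × ℝ := fun p => (p.1, r * p.1 + √(1 - r ^ 2) * p.2) with hT
  have hTm : Measurable T := by fun_prop
  have hpi : P.map (fun ω i => X i ω) = (Measure.pi fun _ : Fin (j + 2) =>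
      (gaussianReal 0 1).prod (gaussianReal 0 1)).map (fun x i => T (x i)) := by
    rw [(iIndepFun_iff_map_fun_eq_pi_map fun i => (hlaw i).aemeasurable).1 hindep]
    simp_rw [fun i => (hlaw i).map_eq]
    have hprob : IsProbabilityMeasure (((gaussianReal 0 1).prod (gaussianReal 0 1)).map T) :=
      Measure.isProbabilityMeasure_map hTm.aemeasurable
    exact (Measure.pi_map_pi (f := fun _ : Fin (j + 2) => T) fun _ => hTm.aemeasurable).symm
  set G : (Fin (j + 2) → ℝ × ℝ) → ENNReal := fun x => F (∑ i, (x i).1 ^ 2, ∑ i, (x i).2 ^ 2)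
  have hG : Measurable G := hF.comp (by fun_prop)
  have h1 : ∫⁻ ω, F (chiSqFst X ω, chiSqSnd X ω) ∂P = ∫⁻ x, G x ∂(P.map (fun ω i => X i ω)) := by
    rw [lintegral_map' hG.aemeasurable (aemeasurable_pi_lambda _ fun i => (hlaw i).aemeasurable)]
    rfl
  have hK : Measurable fun p : (Fin (j + 2) → ℝ) × (Fin (j + 2) → ℝ) =>
      F (∑ i, p.1 i ^ 2, ∑ i, (r * p.1 i + √(1 - r ^ 2) * p.2 i) ^ 2) := hF.comp (by fun_prop)
  have h2 := (measurePreserving_arrowProdEquivProdArrow ℝ ℝ (Fin (j + 2))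
    (fun _ => gaussianReal 0 1) (fun _ => gaussianReal 0 1)).lintegral_comp hK
  rw [h1, hpi, lintegral_map hG (by fun_prop)]
  have h3 : ∫⁻ x, G (fun i => T (x i)) ∂(Measure.pi fun _ : Fin (j + 2) =>
      (gaussianReal 0 1).prod (gaussianReal 0 1)) = _ := h2
  rw [h3, lintegral_prod _ hK.aemeasurable]
  simp only
  have hcont := continuous_condDensity j r
  rw [lintegral_congr fun z => lintegral_sum_shift_sq j hr z (fun v => F (∑ i, z i ^ 2, v))
    (by fun_prop), lintegral_sum_sq j (fun u => ∫⁻ v in Ioi 0, F (u, v) *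
      ENNReal.ofReal (condDensity j r u v))]
  · refine lintegral_congr fun u => ?_
    have hc2 : Measurable fun v => condDensity j r u v :=
      (hcont.comp (by fun_prop : Continuous fun v : ℝ => (u, v))).measurable
    rw [← lintegral_mul_const _ (by fun_prop)]
    refine lintegral_congr fun v => ?_
    rw [mul_assoc, ← ENNReal.ofReal_mul (condDensity_nonneg _ _ _ _), jointDensity,
      mul_comm (condDensity _ _ _ _)]
  · apply Measurable.lintegral_prod_right (f := fun u v => F (u, v) *
      ENNReal.ofReal (condDensity j r u v))
    unfold Function.uncurry
    have := hcont.measurable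
    fun_prop

lemma lintegral_condDensity (j : ℕ) {r : ℝ} (hr : 0 < 1 - r ^ 2) {u : ℝ} (hu : 0 ≤ u) :
    ∫⁻ v in Ioi 0, ENNReal.ofReal (condDensity j r u v) = 1 := by
  have h := lintegral_sum_shift_sq j hr (Pi.single 0 √u) (fun _ => 1) measurable_const
  have hsum : ∑ i : Fin (j + 2), (Pi.single 0 √u : Fin (j + 2) → ℝ) i ^ 2 = u := by
    rw [Finset.sum_eq_single 0 (fun i _ hi => by simp [hi]) (by simp)]
    simp [Real.sq_sqrt hu]
  rw [hsum] at h
  simpa using h.symm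

/-! ### Densities of powers of bivariate distribution functions -/

/-- The integral of `f` over the rectangle `[0, u] × [0, v]`; for continuous `f` it is
differentiable on the whole plane, boundary of the quadrant included. -/
noncomputable def rectInt (f : ℝ → ℝ → ℝ) (u v : ℝ) : ℝ :=
  ∫ t in (0 : ℝ)..u, ∫ w in (0 : ℝ)..v, f t w

/-- The mixed partial derivative of `rectInt f ^ (k + 2)`. -/
noncomputable def powDensity (f : ℝ → ℝ → ℝ) (k : ℕ) (u v : ℝ) : ℝ :=
  (k + 2) * (rectInt f u v ^ (k + 1) * f u v +
    (k + 1) * rectInt f u v ^ k * (∫ t in (0 : ℝ)..u, f t v) * ∫ w in (0 : ℝ)..v, f u w)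

section RectInt

variable {f : ℝ → ℝ → ℝ}

lemma continuous_integral_snd (hf : Continuous fun z : ℝ × ℝ => f z.1 z.2) :
    Continuous fun z : ℝ × ℝ => ∫ w in (0 : ℝ)..z.2, f z.1 w :=
  intervalIntegral.continuous_parametric_intervalIntegral_of_continuous
    (f := fun (z : ℝ × ℝ) w => f z.1 w)
    (hf.comp (by fun_prop : Continuous fun p : (ℝ × ℝ) × ℝ => (p.1.1, p.2))) continuous_snd

lemma continuous_integral_fst (hf : Continuous fun z : ℝ × ℝ => f z.1 z.2) :
    Continuous fun z : ℝ × ℝ => ∫ t in (0 : ℝ)..z.1, f t z.2 :=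
  intervalIntegral.continuous_parametric_intervalIntegral_of_continuous
    (f := fun (z : ℝ × ℝ) t => f t z.2)
    (hf.comp (by fun_prop : Continuous fun p : (ℝ × ℝ) × ℝ => (p.2, p.1.2))) continuous_fst

lemma continuous_rectInt (hf : Continuous fun z : ℝ × ℝ => f z.1 z.2) :
    Continuous fun z : ℝ × ℝ => rectInt f z.1 z.2 :=
  continuous_integral_fst (f := fun t v => ∫ w in (0 : ℝ)..v, f t w) (continuous_integral_snd hf)

lemma rectInt_swap (hf : Continuous fun z : ℝ × ℝ => f z.1 z.2) (u v : ℝ) :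
    rectInt f u v = ∫ w in (0 : ℝ)..v, ∫ t in (0 : ℝ)..u, f t w := by
  refine intervalIntegral_intervalIntegral_swap ?_
  have h : IntegrableOn (fun z : ℝ × ℝ => f z.1 z.2) (uIcc 0 u ×ˢ uIcc 0 v) :=
    hf.continuousOn.integrableOn_compact (isCompact_uIcc.prod isCompact_uIcc)
  exact h.mono_set (prod_mono uIoc_subset_uIcc uIoc_subset_uIcc)

lemma continuous_curry_left (hf : Continuous fun z : ℝ × ℝ => f z.1 z.2) (u : ℝ) :
    Continuous (f u) := hf.comp (by fun_prop : Continuous fun w : ℝ => (u, w))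

lemma continuous_curry_right (hf : Continuous fun z : ℝ × ℝ => f z.1 z.2) (v : ℝ) :
    Continuous fun t => f t v := hf.comp (by fun_prop : Continuous fun t : ℝ => (t, v))

lemma hasDerivAt_rectInt_fst (hf : Continuous fun z : ℝ × ℝ => f z.1 z.2) (u v : ℝ) :
    HasDerivAt (fun t => rectInt f t v) (∫ w in (0 : ℝ)..v, f u w) u := by
  have hc := continuous_curry_right (f := fun t v => ∫ w in (0 : ℝ)..v, f t w)
    (continuous_integral_snd hf) v
  exact intervalIntegral.integral_hasDerivAt_right (hc.intervalIntegrable _ _)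
    (hc.stronglyMeasurableAtFilter _ _) hc.continuousAt

lemma hasDerivAt_rectInt_snd (hf : Continuous fun z : ℝ × ℝ => f z.1 z.2) (u v : ℝ) :
    HasDerivAt (fun w => rectInt f u w) (∫ t in (0 : ℝ)..u, f t v) v := by
  simp_rw [rectInt_swap hf]
  have hc := continuous_curry_left (f := fun u v => ∫ t in (0 : ℝ)..u, f t v)
    (continuous_integral_fst hf) u
  exact intervalIntegral.integral_hasDerivAt_right (hc.intervalIntegrable _ _)
    (hc.stronglyMeasurableAtFilter _ _) hc.continuousAt

lemma continuous_powDensity (hf : Continuous fun z : ℝ × ℝ => f z.1 z.2) (k : ℕ) :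
    Continuous fun z : ℝ × ℝ => powDensity f k z.1 z.2 := by
  have h1 := continuous_integral_fst hf
  have h2 := continuous_integral_snd hf
  have h3 := continuous_rectInt hf
  unfold powDensity
  fun_prop

lemma integral_powDensity (hf : Continuous fun z : ℝ × ℝ => f z.1 z.2) (k : ℕ) (u v : ℝ) :
    ∫ w in (0 : ℝ)..v, powDensity f k u w =
      (k + 2) * rectInt f u v ^ (k + 1) * ∫ w in (0 : ℝ)..v, f u w := by
  have hd (w : ℝ) : HasDerivAt
      (fun w => (k + 2) * rectInt f u w ^ (k + 1) * ∫ w' in (0 : ℝ)..w, f u w')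
      (powDensity f k u w) w := by
    have hc := continuous_curry_left hf u
    have hA : HasDerivAt (fun w => ∫ w' in (0 : ℝ)..w, f u w') (f u w) w :=
      intervalIntegral.integral_hasDerivAt_right (hc.intervalIntegrable _ _)
        (hc.stronglyMeasurableAtFilter _ _) hc.continuousAt
    refine ((((hasDerivAt_rectInt_snd hf u w).pow (k + 1)).const_mul ((k : ℝ) + 2)).mul
      hA).congr_deriv ?_
    simp only [powDensity, Nat.add_sub_cancel, Pi.pow_apply]
    push_cast
    ring
  rw [intervalIntegral.integral_eq_sub_of_hasDerivAt (fun w _ => hd w)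
    ((continuous_curry_left (continuous_powDensity hf k) u).intervalIntegrable _ _)]
  simp

lemma rectInt_pow_eq (hf : Continuous fun z : ℝ × ℝ => f z.1 z.2) (k : ℕ) (u v : ℝ) :
    ∫ t in (0 : ℝ)..u, ((k + 2) * rectInt f t v ^ (k + 1) * ∫ w in (0 : ℝ)..v, f t w) =
      rectInt f u v ^ (k + 2) := by
  have hd (t : ℝ) : HasDerivAt (fun t => rectInt f t v ^ (k + 2))
      ((k + 2) * rectInt f t v ^ (k + 1) * ∫ w in (0 : ℝ)..v, f t w) t := by
    refine ((hasDerivAt_rectInt_fst hf t v).pow (k + 2)).congr_deriv ?_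
    push_cast
    simp
  have hc : Continuous fun t => (k + 2) * rectInt f t v ^ (k + 1) * ∫ w in (0 : ℝ)..v, f t w := by
    have h1 := continuous_curry_right (f := fun t v => ∫ w in (0 : ℝ)..v, f t w)
      (continuous_integral_snd hf) v
    have h2 := continuous_curry_right (continuous_rectInt hf) v
    fun_prop
  rw [intervalIntegral.integral_eq_sub_of_hasDerivAt (fun t _ => hd t)
    (hc.intervalIntegrable _ _)]
  simp [rectInt]

/-- The density of `(x, y) ↦ rectInt f (2 x + b) (2 y + b) ^ (k + 2)`, set to `0` off the open
quadrant where both arguments are positive. The factor `4` is the Jacobian of the scaling. -/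
noncomputable def scaledPowDensity (f : ℝ → ℝ → ℝ) (k : ℕ) (b x y : ℝ) : ℝ :=
  if 0 < 2 * x + b ∧ 0 < 2 * y + b then 4 * powDensity f k (2 * x + b) (2 * y + b) else 0

lemma rectInt_nonneg (h0 : ∀ u v, 0 ≤ f u v) {u v : ℝ} (hu : 0 ≤ u) (hv : 0 ≤ v) :
    0 ≤ rectInt f u v :=
  intervalIntegral.integral_nonneg hu fun _ _ =>
    intervalIntegral.integral_nonneg hv fun _ _ => h0 _ _

lemma powDensity_nonneg (h0 : ∀ u v, 0 ≤ f u v) (k : ℕ) {u v : ℝ} (hu : 0 ≤ u) (hv : 0 ≤ v) :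
    0 ≤ powDensity f k u v := by
  have h1 := rectInt_nonneg h0 hu hv
  have h2 : 0 ≤ ∫ t in (0 : ℝ)..u, f t v :=
    intervalIntegral.integral_nonneg hu fun _ _ => h0 _ _
  have h3 : 0 ≤ ∫ w in (0 : ℝ)..v, f u w :=
    intervalIntegral.integral_nonneg hv fun _ _ => h0 _ _
  have h4 := h0 u v
  unfold powDensity
  positivity

lemma continuous_comp_affine {g : ℝ → ℝ → ℝ} (hg : Continuous fun z : ℝ × ℝ => g z.1 z.2)
    (b : ℝ) : Continuous fun z : ℝ × ℝ => g (2 * z.1 + b) (2 * z.2 + b) :=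
  hg.comp (by fun_prop : Continuous fun z : ℝ × ℝ => (2 * z.1 + b, 2 * z.2 + b))

lemma isPDFOf_scaledPowDensity (hf : Continuous fun z : ℝ × ℝ => f z.1 z.2)
    (h0 : ∀ u v, 0 ≤ f u v) (k : ℕ) (b : ℝ) {H : ℝ → ℝ → ℝ}
    (hH : ∀ u v, 0 ≤ u → 0 ≤ v → H u v = rectInt f u v)
    (hH0 : ∀ u v, u < 0 ∨ v < 0 → H u v = 0) :
    IsPDFOf (fun x y => H (2 * x + b) (2 * y + b) ^ (k + 2)) (scaledPowDensity f k b) := by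
  have hp := continuous_comp_affine (continuous_powDensity hf k) b
  have hind : (fun z : ℝ × ℝ => scaledPowDensity f k b z.1 z.2) =
      (Ioi (-b / 2) ×ˢ Ioi (-b / 2)).indicator
        (fun z => 4 * powDensity f k (2 * z.1 + b) (2 * z.2 + b)) := by
    funext z
    rw [scaledPowDensity, indicator_apply]
    refine if_congr ?_ rfl rfl
    simp only [mem_prod, mem_Ioi]
    constructor <;> rintro ⟨h1, h2⟩ <;> constructor <;> linarith
  have hS : MeasurableSet (Ioi (-b / 2) ×ˢ Ioi (-b / 2)) := measurableSet_Ioi.prod measurableSet_Ioi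
  refine ⟨?_, fun x y => ?_, fun x y => ?_⟩
  · rw [hind]
    exact (hp.measurable.const_mul 4).indicator hS
  · unfold scaledPowDensity
    split_ifs with h
    · exact mul_nonneg (by norm_num) (powDensity_nonneg h0 k h.1.le h.2.le)
    · exact le_rfl
  · have h1 : ∀ z : ℝ × ℝ, ENNReal.ofReal (scaledPowDensity f k b z.1 z.2) =
        (Ioi (-b / 2) ×ˢ Ioi (-b / 2)).indicator
        (fun z => ENNReal.ofReal (4 * powDensity f k (2 * z.1 + b) (2 * z.2 + b))) z := by
      intro z
      rw [show scaledPowDensity f k b z.1 z.2 = _ from congrFun hind z]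
      by_cases hz : z ∈ Ioi (-b / 2) ×ˢ Ioi (-b / 2)
      · simp only [indicator_of_mem hz]
      · simp only [indicator_of_notMem hz, ENNReal.ofReal_zero]
    rw [lintegral_congr h1, setLIntegral_indicator hS, prod_inter_prod, Ioi_inter_Iic,
      Ioi_inter_Iic]
    by_cases hx : -b / 2 ≤ x ∧ -b / 2 ≤ y
    · have hint : IntegrableOn (fun z : ℝ × ℝ => 4 * powDensity f k (2 * z.1 + b) (2 * z.2 + b))
          (Ioc (-b / 2) x ×ˢ Ioc (-b / 2) y) :=
        ((hp.const_mul 4).continuousOn.integrableOn_compact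
          (isCompact_Icc.prod isCompact_Icc)).mono_set
          (prod_mono Ioc_subset_Icc_self Ioc_subset_Icc_self)
      rw [← ofReal_integral_eq_lintegral_ofReal hint]
      · congr 1
        rw [Measure.volume_eq_prod] at hint ⊢
        rw [setIntegral_prod _ hint, ← intervalIntegral.integral_of_le hx.1,
          hH _ _ (by linarith [hx.1]) (by linarith [hx.2]), ← rectInt_pow_eq hf,
          show (0 : ℝ) = 2 * (-b / 2) + b by ring, ← intervalIntegral.mul_integral_comp_mul_add,
          ← intervalIntegral.integral_const_mul]
        refine intervalIntegral.integral_congr fun t _ => ?_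
        rw [← intervalIntegral.integral_of_le hx.2, show 2 * (-b / 2) + b = (0 : ℝ) by ring,
          ← integral_powDensity hf]
        conv_rhs => rw [show (0 : ℝ) = 2 * (-b / 2) + b by ring]
        rw [← intervalIntegral.mul_integral_comp_mul_add, ← intervalIntegral.integral_const_mul,
          ← intervalIntegral.integral_const_mul]
        refine intervalIntegral.integral_congr fun w _ => ?_
        simp only
        ring
      · filter_upwards [ae_restrict_mem (measurableSet_Ioc.prod measurableSet_Ioc)] with z hz
        refine mul_nonneg (by norm_num) (powDensity_nonneg h0 k ?_ ?_)
        · linarith [hz.1.1]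
        · linarith [hz.2.1]
    · have hz : H (2 * x + b) (2 * y + b) = 0 := by
        rw [not_and_or, not_le, not_le] at hx
        apply hH0
        rcases hx with h | h
        · left; linarith
        · right; linarith
      have he : Ioc (-b / 2) x ×ˢ Ioc (-b / 2) y = ∅ := by
        rw [prod_eq_empty_iff, Ioc_eq_empty_iff, Ioc_eq_empty_iff]
        rw [not_and_or, not_le, not_le] at hx
        rcases hx with h | h
        · left; linarith
        · right; linarith
      rw [he, hz]
      simp

end RectInt

lemma IsPDFOf.ae_eq {F f g : ℝ → ℝ → ℝ} (hf : IsPDFOf F f) (hg : IsPDFOf F g) :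
    (fun z : ℝ × ℝ => f z.1 z.2) =ᵐ[volume] fun z => g z.1 z.2 := by
  have hfm := hf.measurable.ennreal_ofReal
  have hgm := hg.measurable.ennreal_ofReal
  have hC : (inferInstance : MeasurableSpace (ℝ × ℝ)) =
      MeasurableSpace.generateFrom (image2 (· ×ˢ ·) (range (Iic : ℝ → Set ℝ)) (range Iic)) := by
    have hsp : IsCountablySpanning (range (Iic : ℝ → Set ℝ)) :=
      ⟨fun n : ℕ => Iic (n : ℝ), fun n => ⟨n, rfl⟩, by
        rw [eq_univ_iff_forall]
        intro x
        obtain ⟨n, hn⟩ := exists_nat_ge x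
        exact mem_iUnion.2 ⟨n, hn⟩⟩
    exact (generateFrom_eq_prod ((borel_eq_generateFrom_Iic ℝ).symm.trans
      (BorelSpace.measurable_eq (α := ℝ)).symm) ((borel_eq_generateFrom_Iic ℝ).symm.trans
      (BorelSpace.measurable_eq (α := ℝ)).symm) hsp hsp).symm
  have hmeas : (volume : Measure (ℝ × ℝ)).withDensity (fun z => ENNReal.ofReal (f z.1 z.2)) =
      volume.withDensity fun z => ENNReal.ofReal (g z.1 z.2) := by
    refine Measure.ext_of_generateFrom_of_iUnion _ (fun n : ℕ => Iic (n : ℝ) ×ˢ Iic (n : ℝ)) hC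
      ((isPiSystem_Iic).prod isPiSystem_Iic) ?_ (fun n => ⟨_, ⟨n, rfl⟩, _, ⟨n, rfl⟩, rfl⟩) ?_ ?_
    · rw [eq_univ_iff_forall]
      rintro ⟨x, y⟩
      obtain ⟨n, hn⟩ := exists_nat_ge (max x y)
      exact mem_iUnion.2 ⟨n, (le_max_left x y).trans hn, (le_max_right x y).trans hn⟩
    · intro n
      rw [withDensity_apply _ (measurableSet_Iic.prod measurableSet_Iic), hf.lintegral_eq]
      exact ENNReal.ofReal_ne_top
    · rintro _ ⟨_, ⟨x, rfl⟩, _, ⟨y, rfl⟩, rfl⟩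
      rw [withDensity_apply _ (measurableSet_Iic.prod measurableSet_Iic), hf.lintegral_eq,
        withDensity_apply _ (measurableSet_Iic.prod measurableSet_Iic), hg.lintegral_eq]
  have hae := (withDensity_eq_iff_of_sigmaFinite hfm.aemeasurable hgm.aemeasurable).1 hmeas
  filter_upwards [hae] with z hz
  exact (ENNReal.ofReal_eq_ofReal_iff (hf.nonneg _ _) (hg.nonneg _ _)).1 hz

/-- Continuous versions of a density on an open set agree there. -/
lemma IsPDFOf.eqOn {F f g : ℝ → ℝ → ℝ} (hf : IsPDFOf F f) (hg : IsPDFOf F g) {U : Set (ℝ × ℝ)}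
    (hU : IsOpen U) (hfc : ContinuousOn (fun z : ℝ × ℝ => f z.1 z.2) U)
    (hgc : ContinuousOn (fun z : ℝ × ℝ => g z.1 z.2) U) :
    EqOn (fun z : ℝ × ℝ => f z.1 z.2) (fun z => g z.1 z.2) U :=
  Measure.eqOn_open_of_ae_eq (ae_restrict_of_ae (hf.ae_eq hg)) hU hfc hgc

/-! ### Laplace asymptotics of the Bessel-type integral -/

lemma tendsto_sqrt_mul_sin (z : ℝ) :
    Tendsto (fun κ : ℝ => √κ * Real.sin (z / √κ)) atTop (𝓝 z) := by
  have hd : HasDerivAt (fun h : ℝ => Real.sin (z * h)) z 0 := by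
    have h := (Real.hasDerivAt_sin (z * 0)).comp (0 : ℝ) ((hasDerivAt_id (0 : ℝ)).const_mul z)
    simpa [Function.comp_def] using h
  have hs := hd.tendsto_slope_zero_right
  have hinv : Tendsto (fun κ : ℝ => (√κ)⁻¹) atTop (𝓝[>] 0) :=
    tendsto_inv_atTop_nhdsGT_zero.comp Real.tendsto_sqrt_atTop
  refine (hs.comp hinv).congr fun κ => ?_
  simp [div_eq_mul_inv]

lemma besselInt_rescaled (j : ℕ) {κ : ℝ} (hκ : 0 < κ) :
    √κ ^ (j + 1) * Real.exp (-κ) * besselInt j κ =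
      ∫ z in Ioi 0, (Ioc 0 (Real.pi * √κ)).indicator (fun z =>
        Real.exp (κ * (Real.cos (z / √κ) - 1)) * (√κ * Real.sin (z / √κ)) ^ j) z := by
  have hs : 0 < √κ := Real.sqrt_pos.2 hκ
  rw [setIntegral_indicator measurableSet_Ioc,
    inter_eq_right.2 (Ioc_subset_Ioi_self : Ioc 0 (Real.pi * √κ) ⊆ Ioi 0),
    ← intervalIntegral.integral_of_le (by positivity)]
  have h := intervalIntegral.integral_comp_div (a := 0) (b := Real.pi * √κ)
    (fun θ => Real.exp (κ * (Real.cos θ - 1)) * (√κ * Real.sin θ) ^ j) hs.ne'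
  rw [h, zero_div, mul_div_cancel_right₀ _ hs.ne', smul_eq_mul, besselInt,
    ← intervalIntegral.integral_const_mul, ← intervalIntegral.integral_const_mul]
  refine intervalIntegral.integral_congr fun θ _ => ?_
  rw [mul_sub, mul_one, sub_eq_add_neg, Real.exp_add, mul_pow]
  ring

/-- The main contribution to `besselInt j κ` comes from angles of order `1 / √κ`, where the
integrand is Gaussian. -/
lemma tendsto_besselInt (j : ℕ) :
    Tendsto (fun κ : ℝ => √κ ^ (j + 1) * Real.exp (-κ) * besselInt j κ) atTop
      (𝓝 (gaussMoment j)) := by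
  have key : Tendsto (fun κ : ℝ => ∫ z in Ioi 0, (Ioc 0 (Real.pi * √κ)).indicator (fun z =>
        Real.exp (κ * (Real.cos (z / √κ) - 1)) * (√κ * Real.sin (z / √κ)) ^ j) z) atTop
      (𝓝 (gaussMoment j)) := by
    -- The quadratic bound `cos θ ≤ 1 - 2 θ² / π²` on `[0, π]` gives the Gaussian majorant.
    refine tendsto_integral_filter_of_dominated_convergence
      (fun z => z ^ j * Real.exp (-(2 / Real.pi ^ 2) * z ^ 2)) ?_ ?_ ?_ ?_
    · refine Eventually.of_forall fun κ => ?_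
      exact ((Measurable.indicator (by fun_prop) measurableSet_Ioc)).aestronglyMeasurable
    · filter_upwards [eventually_gt_atTop 0] with κ hκ
      have hs : 0 < √κ := Real.sqrt_pos.2 hκ
      filter_upwards [ae_restrict_mem measurableSet_Ioi] with z hz
      have hz' : (0 : ℝ) < z := hz
      by_cases h : z ∈ Ioc 0 (Real.pi * √κ)
      · rw [indicator_of_mem h]
        have hθ0 : 0 ≤ z / √κ := by positivity
        have hθ : z / √κ ≤ Real.pi := by rw [div_le_iff₀ hs]; exact h.2
        have hsin := Real.sin_nonneg_of_nonneg_of_le_pi hθ0 hθ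
        have hsin' : √κ * Real.sin (z / √κ) ≤ z := by
          have := mul_le_mul_of_nonneg_left (Real.sin_le hθ0) hs.le
          rwa [mul_div_cancel₀ _ hs.ne'] at this
        have hcos := Real.cos_le_one_sub_mul_cos_sq (x := z / √κ)
          (by rwa [abs_of_nonneg hθ0])
        have hexp : κ * (Real.cos (z / √κ) - 1) ≤ -(2 / Real.pi ^ 2) * z ^ 2 := by
          have h1 : κ * (Real.cos (z / √κ) - 1) ≤ κ * (-(2 / Real.pi ^ 2 * (z / √κ) ^ 2)) :=
            mul_le_mul_of_nonneg_left (by linarith) hκ.le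
          rw [div_pow, Real.sq_sqrt hκ.le] at h1
          refine h1.trans (le_of_eq ?_)
          field_simp
        rw [Real.norm_of_nonneg (by positivity), mul_comm (z ^ j)]
        gcongr
      · rw [indicator_of_notMem h]
        simp only [norm_zero]
        positivity
    · have h := integrableOn_rpow_mul_exp_neg_mul_rpow (p := 2) (s := j) (b := 2 / Real.pi ^ 2)
        (by have : (0:ℝ) ≤ j := by positivity
            linarith) (by norm_num) (by positivity)
      refine h.congr_fun (fun x _ => ?_) measurableSet_Ioi
      simp only [Real.rpow_natCast, Real.rpow_ofNat]
    · filter_upwards [ae_restrict_mem measurableSet_Ioi] with z hz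
      have hz' : (0 : ℝ) < z := hz
      have hlim : Tendsto (fun κ : ℝ => Real.exp (-2 * (√κ * Real.sin (z / 2 / √κ)) ^ 2) *
          (√κ * Real.sin (z / √κ)) ^ j) atTop (𝓝 (Real.exp (-2 * (z / 2) ^ 2) * z ^ j)) :=
        (((tendsto_sqrt_mul_sin (z / 2)).pow 2).const_mul (-2)).rexp.mul
          ((tendsto_sqrt_mul_sin z).pow j)
      have heq : Real.exp (-2 * (z / 2) ^ 2) * z ^ j = z ^ j * Real.exp (-z ^ 2 / 2) := by
        rw [mul_comm]; congr 2; ring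
      rw [heq] at hlim
      refine hlim.congr' ?_
      have hbig : ∀ᶠ κ : ℝ in atTop, z ≤ Real.pi * √κ :=
        (Real.tendsto_sqrt_atTop.const_mul_atTop Real.pi_pos).eventually_ge_atTop z
      filter_upwards [hbig, eventually_gt_atTop 0] with κ h1 hκ
      rw [indicator_of_mem (show z ∈ Ioc 0 (Real.pi * √κ) from ⟨hz', h1⟩)]
      congr 2
      have h2 : z / √κ = 2 * (z / 2 / √κ) := by ring
      rw [h2, Real.cos_two_mul, Real.cos_sq', mul_pow, Real.sq_sqrt hκ.le]
      ring
  refine key.congr' ?_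
  filter_upwards [eventually_gt_atTop 0] with κ hκ
  exact (besselInt_rescaled j hκ).symm

/-! ### Limit of the conditional density -/

/-- The Gaussian shape of the conditional density, with the Bessel-type integral in the
normalization of `tendsto_besselInt`. -/
lemma two_mul_condDensity (j : ℕ) {r u v : ℝ} (hr : 0 < 1 - r ^ 2) (hr0 : r ≠ 0) (hu : 0 < u)
    (hv : 0 < v) :
    2 * condDensity j r u v = 1 / √(2 * Real.pi) *
      (√(|r| * √u * √v / (1 - r ^ 2)) ^ (j + 1) * Real.exp (-(|r| * √u * √v / (1 - r ^ 2))) *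
        besselInt j (|r| * √u * √v / (1 - r ^ 2)) / gaussMoment j) *
      Real.exp (-((√v - |r| * √u) / √(1 - r ^ 2)) ^ 2 / 2) *
      (√v ^ j / (√(1 - r ^ 2) * √(|r| * √u * √v) ^ (j + 1))) := by
  have hc := gaussMoment_pos j
  have hs : 0 < √(1 - r ^ 2) := Real.sqrt_pos.2 hr
  have hra : 0 < |r| := abs_pos.2 hr0
  have hus : 0 < √u := Real.sqrt_pos.2 hu
  have hvs : 0 < √v := Real.sqrt_pos.2 hv
  have hq : 0 < √(|r| * √u * √v) := Real.sqrt_pos.2 (by positivity)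
  have habs : besselInt j (r * √u * √v / (1 - r ^ 2)) =
      besselInt j (|r| * √u * √v / (1 - r ^ 2)) := by
    rw [← besselInt_abs, abs_div, abs_mul, abs_mul, abs_of_pos hus, abs_of_pos hvs, abs_of_pos hr]
  have hexp : Real.exp (-(v + r ^ 2 * u) / (2 * (1 - r ^ 2))) =
      Real.exp (-(|r| * √u * √v / (1 - r ^ 2))) *
        Real.exp (-((√v - |r| * √u) / √(1 - r ^ 2)) ^ 2 / 2) := by
    rw [← Real.exp_add]
    congr 1
    rw [div_pow, Real.sq_sqrt hr.le]
    have h1 : (√v - |r| * √u) ^ 2 = v + r ^ 2 * u - 2 * (|r| * √u * √v) := by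
      rw [sub_sq, mul_pow, Real.sq_sqrt hu.le, Real.sq_sqrt hv.le, sq_abs]
      ring
    rw [h1]
    field_simp
    ring
  have hsq : √(|r| * √u * √v / (1 - r ^ 2)) = √(|r| * √u * √v) / √(1 - r ^ 2) :=
    Real.sqrt_div (by positivity) _
  unfold condDensity
  rw [habs, hexp, hsq]
  generalize besselInt j _ = B
  generalize Real.exp (-(|r| * √u * √v / (1 - r ^ 2))) = E₁
  generalize Real.exp (-((√v - |r| * √u) / √(1 - r ^ 2)) ^ 2 / 2) = E₂
  generalize √(|r| * √u * √v) = q at *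
  generalize √(1 - r ^ 2) = s at *
  rw [div_pow]
  field_simp
  ring

section Kernel

variable {b r : ℕ → ℝ} {l : ℝ}

lemma tendsto_sq_one (hb : Tendsto b atTop atTop)
    (hl : Tendsto (fun n => b n * (1 - r n ^ 2)) atTop (𝓝 l)) :
    Tendsto (fun n => r n ^ 2) atTop (𝓝 1) := by
  have h1 : Tendsto (fun n => 1 - (b n * (1 - r n ^ 2)) / b n) atTop (𝓝 (1 - 0)) :=
    tendsto_const_nhds.sub (hl.div_atTop hb)
  rw [sub_zero] at h1
  refine h1.congr' ?_
  filter_upwards [hb.eventually_gt_atTop 0] with n hn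
  field_simp
  ring

lemma tendsto_sqrt_ratio (hb : Tendsto b atTop atTop) (x : ℝ) :
    Tendsto (fun n => √((2 * x + b n) / b n)) atTop (𝓝 1) := by
  have h1 : Tendsto (fun n => 2 * x / b n + 1) atTop (𝓝 (0 + 1)) :=
    (tendsto_const_nhds.div_atTop hb).add_const 1
  have h2 := h1.sqrt
  rw [zero_add, Real.sqrt_one] at h2
  refine h2.congr' ?_
  filter_upwards [hb.eventually_gt_atTop 0] with n hn
  congr 1
  field_simp

lemma tendsto_condDensity (hb : Tendsto b atTop atTop) (hl0 : 0 < l)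
    (hr : ∀ᶠ n in atTop, 0 < 1 - r n ^ 2)
    (hl : Tendsto (fun n => b n * (1 - r n ^ 2)) atTop (𝓝 l)) (j : ℕ) (x y : ℝ) :
    Tendsto (fun n => 2 * condDensity j (r n) (2 * x + b n) (2 * y + b n)) atTop
      (𝓝 (1 / √l * stdphi (√l / 2 + (y - x) / √l))) := by
  have hsl : 0 < √l := Real.sqrt_pos.2 hl0
  have hr2 := tendsto_sq_one hb hl
  have hra : Tendsto (fun n => |r n|) atTop (𝓝 1) := by
    have := hr2.sqrt
    simpa [Real.sqrt_sq_eq_abs] using this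
  have hα := tendsto_sqrt_ratio hb x
  have hβ := tendsto_sqrt_ratio hb y
  have hσ := hl.sqrt
  have hbx : ∀ᶠ n in atTop, 0 < 2 * x + b n :=
    (tendsto_atTop_add_const_left _ (2 * x) hb).eventually_gt_atTop 0
  have hby : ∀ᶠ n in atTop, 0 < 2 * y + b n :=
    (tendsto_atTop_add_const_left _ (2 * y) hb).eventually_gt_atTop 0
  have hr0 : ∀ᶠ n in atTop, r n ≠ 0 := by
    filter_upwards [hr2.eventually_ne one_ne_zero] with n hn h0
    simp [h0] at hn
  have hfac (z : ℝ) {n : ℕ} (hn : 0 < b n) :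
      √(2 * z + b n) = √(b n) * √((2 * z + b n) / b n) := by
    rw [← Real.sqrt_mul hn.le]
    congr 1
    field_simp
  have hκ : Tendsto (fun n => |r n| * √(2 * x + b n) * √(2 * y + b n) / (1 - r n ^ 2)) atTop
      atTop := by
    have h1 : Tendsto (fun n => (|r n| * √((2 * x + b n) / b n) * √((2 * y + b n) / b n)) /
        (b n * (1 - r n ^ 2)) * (b n * b n)) atTop atTop := by
      refine Tendsto.pos_mul_atTop (C := 1 * 1 * 1 / l) (by positivity)
        (((hra.mul hα).mul hβ).div hl hl0.ne') (hb.atTop_mul_atTop₀ hb)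
    refine h1.congr' ?_
    filter_upwards [hb.eventually_gt_atTop 0, hr] with n hn hrn
    rw [hfac x hn, hfac y hn]
    have := Real.mul_self_sqrt hn.le
    field_simp
    rw [Real.sq_sqrt hn.le]
    ring
  have hbes := ((tendsto_besselInt j).comp hκ).div_const (gaussMoment j)
  rw [div_self (gaussMoment_pos j).ne'] at hbes
  have hE : Tendsto (fun n => (√(2 * y + b n) - |r n| * √(2 * x + b n)) / √(1 - r n ^ 2)) atTop
      (𝓝 (√l / 2 + (y - x) / √l)) := by
    have h1 : Tendsto (fun n => (2 * (y - r n ^ 2 * x) + b n * (1 - r n ^ 2)) /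
        (√(b n * (1 - r n ^ 2)) * (√((2 * y + b n) / b n) + |r n| * √((2 * x + b n) / b n))))
        atTop (𝓝 ((2 * (y - 1 * x) + l) / (√l * (1 + 1 * 1)))) :=
      (((((hr2.mul_const x).const_sub y)).const_mul 2).add hl).div
        (hσ.mul (hβ.add (hra.mul hα))) (by positivity)
    have h2 : (2 * (y - 1 * x) + l) / (√l * (1 + 1 * 1)) = √l / 2 + (y - x) / √l := by
      have := Real.sq_sqrt hl0.le
      field_simp
      rw [this]
      ring
    rw [h2] at h1
    refine h1.congr' ?_
    filter_upwards [hb.eventually_gt_atTop 0, hr, hbx, hby] with n hn hrn hx hy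
    have hs : 0 < √(1 - r n ^ 2) := Real.sqrt_pos.2 hrn
    have hbs : 0 < √(b n) := Real.sqrt_pos.2 hn
    have hxs : 0 < √(2 * x + b n) := Real.sqrt_pos.2 hx
    have hys : 0 < √(2 * y + b n) := Real.sqrt_pos.2 hy
    -- Rationalize `√v - |r| √u = (v - r² u) / (√v + |r| √u)`.
    have hden : √(b n * (1 - r n ^ 2)) *
        (√((2 * y + b n) / b n) + |r n| * √((2 * x + b n) / b n)) =
        √(1 - r n ^ 2) * (√(2 * y + b n) + |r n| * √(2 * x + b n)) := by
      rw [hfac x hn, hfac y hn, Real.sqrt_mul hn.le]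
      ring
    have hnum : 2 * (y - r n ^ 2 * x) + b n * (1 - r n ^ 2) =
        (√(2 * y + b n) - |r n| * √(2 * x + b n)) *
          (√(2 * y + b n) + |r n| * √(2 * x + b n)) := by
      have e1 := Real.sq_sqrt hx.le
      have e2 := Real.sq_sqrt hy.le
      have e3 := sq_abs (r n)
      linear_combination -e2 + r n ^ 2 * e1 + √(2 * x + b n) ^ 2 * e3
    have hpos : 0 < √(2 * y + b n) + |r n| * √(2 * x + b n) := by positivity
    rw [hden, hnum]
    field_simp
  have hP : Tendsto (fun n => √(2 * y + b n) ^ j / (√(1 - r n ^ 2) *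
      √(|r n| * √(2 * x + b n) * √(2 * y + b n)) ^ (j + 1))) atTop (𝓝 (1 / √l)) := by
    have h1 : Tendsto (fun n => √((2 * y + b n) / b n) ^ j / (√(b n * (1 - r n ^ 2)) *
        √(|r n| * √((2 * x + b n) / b n) * √((2 * y + b n) / b n)) ^ (j + 1))) atTop
        (𝓝 (1 ^ j / (√l * √(1 * 1 * 1) ^ (j + 1)))) :=
      (hβ.pow j).div (hσ.mul (((hra.mul hα).mul hβ).sqrt.pow (j + 1))) (by simp [hsl.ne'])
    have h2 : (1 : ℝ) ^ j / (√l * √(1 * 1 * 1) ^ (j + 1)) = 1 / √l := by simp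
    rw [h2] at h1
    refine h1.congr' ?_
    filter_upwards [hb.eventually_gt_atTop 0] with n hn
    have hbs : 0 < √(b n) := Real.sqrt_pos.2 hn
    have h3 : √(|r n| * √(2 * x + b n) * √(2 * y + b n)) =
        √(b n) * √(|r n| * √((2 * x + b n) / b n) * √((2 * y + b n) / b n)) := by
      rw [← Real.sqrt_mul hn.le, hfac x hn, hfac y hn]
      congr 1
      linear_combination (|r n| * √((2 * x + b n) / b n) * √((2 * y + b n) / b n)) *
        Real.mul_self_sqrt hn.le
    rw [h3, hfac y hn, Real.sqrt_mul hn.le, mul_pow, mul_pow]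
    have : √(1 - r n ^ 2) * (√(b n) ^ (j + 1) *
        √(|r n| * √((2 * x + b n) / b n) * √((2 * y + b n) / b n)) ^ (j + 1)) =
        √(b n) ^ j * (√(b n) * √(1 - r n ^ 2) *
          √(|r n| * √((2 * x + b n) / b n) * √((2 * y + b n) / b n)) ^ (j + 1)) := by ring
    rw [this, mul_div_mul_left _ _ (by positivity)]
  have hall := ((hbes.const_mul (1 / √(2 * Real.pi))).mul
    (((hE.pow 2).neg.div_const 2).rexp)).mul hP
  have hval : 1 / √(2 * Real.pi) * 1 * Real.exp (-(√l / 2 + (y - x) / √l) ^ 2 / 2) * (1 / √l) =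
      1 / √l * stdphi (√l / 2 + (y - x) / √l) := by
    unfold stdphi gaussianPDFReal
    simp
    ring
  rw [hval] at hall
  refine hall.congr' ?_
  filter_upwards [hr, hr0, hbx, hby] with n h1 h2 h3 h4
  rw [two_mul_condDensity j h1 h2 h3 h4]
  rfl

end Kernel

/-! ### The standard Gaussian distribution function -/

lemma continuous_stdphi : Continuous stdphi := by
  unfold stdphi gaussianPDFReal
  fun_prop

lemma integrable_stdphi : Integrable stdphi := integrable_gaussianPDFReal 0 1

lemma stdPhi_eq_integral (x : ℝ) : stdPhi x = ∫ t in Iic x, stdphi t := by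
  rw [stdPhi, cdf_eq_real, measureReal_def, gaussianReal_apply_eq_integral 0 one_ne_zero,
    ENNReal.toReal_ofReal (integral_nonneg fun t => gaussianPDFReal_nonneg 0 1 t)]
  rfl

lemma hasDerivAt_stdPhi (x : ℝ) : HasDerivAt stdPhi (stdphi x) x := by
  have h (y : ℝ) : stdPhi y = stdPhi 0 + ∫ t in (0 : ℝ)..y, stdphi t := by
    rw [stdPhi_eq_integral, stdPhi_eq_integral, ← intervalIntegral.integral_Iic_sub_Iic
      integrable_stdphi.integrableOn integrable_stdphi.integrableOn]
    ring
  rw [funext h]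
  exact (intervalIntegral.integral_hasDerivAt_right (continuous_stdphi.intervalIntegrable _ _)
    (continuous_stdphi.stronglyMeasurableAtFilter _ _) continuous_stdphi.continuousAt).const_add _

lemma tendsto_stdPhi_atTop : Tendsto stdPhi atTop (𝓝 1) := tendsto_cdf_atTop _

lemma tendsto_stdPhi_atBot : Tendsto stdPhi atBot (𝓝 0) := tendsto_cdf_atBot _

section HuslerReiss

variable {l : ℝ}

lemma tendsto_affine_atTop (hl : 0 < l) (x : ℝ) :
    Tendsto (fun y => √l / 2 + (y - x) / √l) atTop atTop :=
  tendsto_atTop_add_const_left _ _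
    ((tendsto_atTop_add_const_right _ (-x) tendsto_id).atTop_div_const (Real.sqrt_pos.2 hl))

lemma tendsto_affine_atBot (hl : 0 < l) (x : ℝ) :
    Tendsto (fun y => √l / 2 + (y - x) / √l) atBot atBot :=
  tendsto_atBot_add_const_left _ _
    ((tendsto_atBot_add_const_right _ (-x) tendsto_id).atBot_div_const (Real.sqrt_pos.2 hl))

lemma hasDerivAt_stdPhi_affine (x y : ℝ) :
    HasDerivAt (fun y => stdPhi (√l / 2 + (y - x) / √l))
      (1 / √l * stdphi (√l / 2 + (y - x) / √l)) y := by
  have h := (hasDerivAt_stdPhi (√l / 2 + (y - x) / √l)).comp y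
    ((((hasDerivAt_id y).sub_const x).div_const √l).const_add (√l / 2))
  rw [mul_comm]
  exact h

lemma integrable_stdphi_affine (hl : 0 < l) (x : ℝ) :
    Integrable fun y => 1 / √l * stdphi (√l / 2 + (y - x) / √l) := by
  have h := ((integrable_stdphi.comp_add_left (√l / 2)).comp_div
    (Real.sqrt_pos.2 hl).ne').comp_sub_right x
  exact h.const_mul _

lemma integral_Iic_stdphi_affine (hl : 0 < l) (x y : ℝ) :
    ∫ t in Iic y, 1 / √l * stdphi (√l / 2 + (t - x) / √l) =
      stdPhi (√l / 2 + (y - x) / √l) := by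
  rw [integral_Iic_of_hasDerivAt_of_tendsto' (fun t _ => hasDerivAt_stdPhi_affine x t)
    (integrable_stdphi_affine hl x).integrableOn
    (tendsto_stdPhi_atBot.comp (tendsto_affine_atBot hl x)), sub_zero]

lemma integral_stdphi_affine (hl : 0 < l) (x : ℝ) :
    ∫ t, 1 / √l * stdphi (√l / 2 + (t - x) / √l) = 1 := by
  rw [integral_of_hasDerivAt_of_tendsto (fun t => hasDerivAt_stdPhi_affine x t)
    (integrable_stdphi_affine hl x) (tendsto_stdPhi_atBot.comp (tendsto_affine_atBot hl x))
    (tendsto_stdPhi_atTop.comp (tendsto_affine_atTop hl x)), sub_zero]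

lemma exp_mul_stdphi_symm (hl : 0 < l) (x y : ℝ) :
    Real.exp (-x) * stdphi (√l / 2 + (y - x) / √l) =
      Real.exp (-y) * stdphi (√l / 2 + (x - y) / √l) := by
  have hs : 0 < √l := Real.sqrt_pos.2 hl
  unfold stdphi gaussianPDFReal
  rw [mul_left_comm, ← Real.exp_add, mul_left_comm, ← Real.exp_add]
  congr 2
  simp only [NNReal.coe_one]
  field_simp
  ring

/-- The integral that turns the conditional limit law into the exponent of `huslerReissCDF`. -/
lemma integral_Ioi_exp_mul_stdPhi (hl : 0 < l) (x y : ℝ) :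
    ∫ t in Ioi y, Real.exp (-t) * stdPhi (√l / 2 + (x - t) / √l) =
      Real.exp (-x) * stdPhi (√l / 2 + (y - x) / √l) +
        Real.exp (-y) * stdPhi (√l / 2 + (x - y) / √l) - Real.exp (-x) := by
  have hs : 0 < √l := Real.sqrt_pos.2 hl
  have hd (t : ℝ) : HasDerivAt (fun t => -(Real.exp (-x) * stdPhi (√l / 2 + (t - x) / √l) +
      Real.exp (-t) * stdPhi (√l / 2 + (x - t) / √l)))
      (Real.exp (-t) * stdPhi (√l / 2 + (x - t) / √l)) t := by
    have h1 := (hasDerivAt_stdPhi_affine (l := l) x t).const_mul (Real.exp (-x))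
    have h2 : HasDerivAt (fun t => Real.exp (-t)) (-Real.exp (-t)) t := by
      simpa using (hasDerivAt_neg t).exp
    have h3 : HasDerivAt (fun t => stdPhi (√l / 2 + (x - t) / √l))
        (stdphi (√l / 2 + (x - t) / √l) * (-1 / √l)) t :=
      (hasDerivAt_stdPhi (√l / 2 + (x - t) / √l)).comp t
        ((((hasDerivAt_id t).const_sub x).div_const √l).const_add (√l / 2))
    refine (h1.add (h2.mul h3)).neg.congr_deriv ?_
    have := exp_mul_stdphi_symm hl x t
    linear_combination (-(1 / √l)) * this
  have hlim : Tendsto (fun t => -(Real.exp (-x) * stdPhi (√l / 2 + (t - x) / √l) +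
      Real.exp (-t) * stdPhi (√l / 2 + (x - t) / √l))) atTop
      (𝓝 (-(Real.exp (-x) * 1 + 0 * 0))) := by
    have h1 := tendsto_stdPhi_atTop.comp (tendsto_affine_atTop hl x)
    have h2 : Tendsto (fun t => √l / 2 + (x - t) / √l) atTop atBot := by
      refine tendsto_atBot_add_const_left _ _ (Tendsto.atBot_div_const hs ?_)
      exact tendsto_atBot_add_const_left _ x tendsto_neg_atTop_atBot
    exact ((h1.const_mul _).add ((Real.tendsto_exp_neg_atTop_nhds_zero).mul
      (tendsto_stdPhi_atBot.comp h2))).neg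
  have hnn (t : ℝ) : 0 ≤ Real.exp (-t) * stdPhi (√l / 2 + (x - t) / √l) :=
    mul_nonneg (Real.exp_pos _).le (cdf_nonneg _ _)
  rw [integral_Ioi_of_hasDerivAt_of_nonneg' (fun t _ => hd t) (fun t _ => hnn t) hlim]
  ring

end HuslerReiss

/-! ### Convergence of the conditional distribution function -/

/-- Scheffé's lemma: pointwise convergence of probability densities implies convergence of the
integrals over any set. -/
lemma tendsto_setIntegral_of_density {f : ℕ → ℝ → ℝ} {g : ℝ → ℝ}
    (hf : ∀ᶠ n in atTop, Integrable (f n))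
    (hfm : ∀ n, Measurable (f n))
    (hf0 : ∀ n x, 0 ≤ f n x) (hf1 : ∀ᶠ n in atTop, ∫ x, f n x = 1)
    (hg : Integrable g) (hg1 : ∫ x, g x = 1)
    (hlim : ∀ x, Tendsto (fun n => f n x) atTop (𝓝 (g x))) (s : Set ℝ) :
    Tendsto (fun n => ∫ x in s, f n x) atTop (𝓝 (∫ x in s, g x)) := by
  have hg0 (x : ℝ) : 0 ≤ g x := ge_of_tendsto' (hlim x) fun n => hf0 n x
  have hpos : Tendsto (fun n => ∫ x, max (g x - f n x) 0) atTop (𝓝 (∫ _ : ℝ, (0 : ℝ))) := by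
    refine tendsto_integral_of_dominated_convergence g (fun n => ?_) hg (fun n => ?_) ?_
    · exact (hg.aestronglyMeasurable.sub (hfm n).aestronglyMeasurable).sup
        aestronglyMeasurable_const
    · refine Eventually.of_forall fun x => ?_
      rw [Real.norm_of_nonneg (le_max_right _ _)]
      exact max_le (by linarith [hf0 n x]) (hg0 x)
    · refine Eventually.of_forall fun x => ?_
      have := ((hlim x).const_sub (g x)).max (tendsto_const_nhds (x := (0 : ℝ)))
      simpa using this
  rw [integral_zero] at hpos
  have hbound : Tendsto (fun n => 2 * ∫ x, max (g x - f n x) 0) atTop (𝓝 0) := by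
    simpa using hpos.const_mul 2
  rw [tendsto_iff_norm_sub_tendsto_zero]
  refine squeeze_zero' (Eventually.of_forall fun n => norm_nonneg _) ?_ hbound
  filter_upwards [hf, hf1] with n hn hn1
  have hmax : Integrable fun x => max (g x - f n x) 0 := (hg.sub hn).pos_part
  have hgf : Integrable fun x => g x - f n x := hg.sub hn
  -- Since both densities have mass one, the positive part of `g - f n` carries half of the
  -- `L¹` distance, and it is dominated by `g`.
  have habs (x : ℝ) : ‖f n x - g x‖ = 2 * max (g x - f n x) 0 - (g x - f n x) := by
    rw [Real.norm_eq_abs]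
    rcases le_total (g x - f n x) 0 with h | h
    · rw [max_eq_right h, abs_of_nonneg (by linarith)]; ring
    · rw [max_eq_left h, abs_of_nonpos (by linarith)]; ring
  calc ‖(∫ x in s, f n x) - ∫ x in s, g x‖ = ‖∫ x in s, (f n x - g x)‖ := by
        rw [integral_sub hn.integrableOn hg.integrableOn]
    _ ≤ ∫ x in s, ‖f n x - g x‖ := norm_integral_le_integral_norm _
    _ ≤ ∫ x, ‖f n x - g x‖ := setIntegral_le_integral (hn.sub hg).norm
        (Eventually.of_forall fun x => norm_nonneg _)
    _ = 2 * ∫ x, max (g x - f n x) 0 := by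
        simp_rw [habs]
        rw [integral_sub (hmax.const_mul 2) hgf, integral_sub hg hn, hn1, hg1,
          integral_const_mul]
        ring

lemma setIntegral_Ioi_comp_affine (y b : ℝ) (f : ℝ → ℝ) :
    ∫ x in Ioi y, 2 * f (2 * x + b) = ∫ w in Ioi (2 * y + b), f w := by
  have h := integral_image_eq_integral_abs_deriv_smul (s := Ioi y) (f := fun x : ℝ => 2 * x + b)
    (f' := fun _ => 2) measurableSet_Ioi
    (fun x _ => by simpa using (((hasDerivAt_id x).const_mul 2).add_const b).hasDerivWithinAt)
    (fun x _ z _ hxz => by simpa using hxz) f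
  have him : (fun x : ℝ => 2 * x + b) '' Ioi y = Ioi (2 * y + b) := by
    ext w
    simp only [mem_image, mem_Ioi]
    constructor
    · rintro ⟨x, hx, rfl⟩; linarith
    · intro hw; exact ⟨(w - b) / 2, by linarith, by ring⟩
  rw [him] at h
  rw [h]
  simp

/-- The conditional distribution function of the second component at `v`, given that the first one
is `u`. -/
noncomputable def chiSqCondCDF (j : ℕ) (r u v : ℝ) : ℝ := ∫ w in (0 : ℝ)..v, condDensity j r u w

lemma continuous_chiSqCondCDF (j : ℕ) (r : ℝ) :
    Continuous fun z : ℝ × ℝ => chiSqCondCDF j r z.1 z.2 :=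
  continuous_integral_snd (continuous_condDensity j r)

lemma integrableOn_condDensity (j : ℕ) {r : ℝ} (hr : 0 < 1 - r ^ 2) {u : ℝ} (hu : 0 ≤ u) :
    IntegrableOn (condDensity j r u) (Ioi 0) := by
  refine ⟨(continuous_curry_left (continuous_condDensity j r) u).aestronglyMeasurable, ?_⟩
  rw [hasFiniteIntegral_iff_ofReal (Eventually.of_forall fun v => condDensity_nonneg j r u v),
    lintegral_condDensity j hr hu]
  exact ENNReal.one_lt_top

lemma integral_condDensity (j : ℕ) {r : ℝ} (hr : 0 < 1 - r ^ 2) {u : ℝ} (hu : 0 ≤ u) :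
    ∫ v in Ioi 0, condDensity j r u v = 1 := by
  rw [integral_eq_lintegral_of_nonneg_ae
    (Eventually.of_forall fun v => condDensity_nonneg j r u v)
    (integrableOn_condDensity j hr hu).aestronglyMeasurable, lintegral_condDensity j hr hu]
  simp

lemma chiSqCondCDF_nonneg (j : ℕ) (r u : ℝ) {v : ℝ} (hv : 0 ≤ v) : 0 ≤ chiSqCondCDF j r u v :=
  intervalIntegral.integral_nonneg hv fun w _ => condDensity_nonneg j r u w

lemma chiSqCondCDF_le_one (j : ℕ) {r : ℝ} (hr : 0 < 1 - r ^ 2) {u v : ℝ} (hu : 0 ≤ u) (hv : 0 ≤ v) :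
    chiSqCondCDF j r u v ≤ 1 := by
  rw [chiSqCondCDF, intervalIntegral.integral_of_le hv, ← integral_condDensity j hr hu]
  exact setIntegral_mono_set (integrableOn_condDensity j hr hu)
    (Eventually.of_forall fun w => condDensity_nonneg j r u w) Ioc_subset_Ioi_self.eventuallyLE

lemma tendsto_chiSqCondCDF {b r : ℕ → ℝ} {l : ℝ} (hb : Tendsto b atTop atTop) (hl0 : 0 < l)
    (hr : ∀ᶠ n in atTop, 0 < 1 - r n ^ 2)
    (hl : Tendsto (fun n => b n * (1 - r n ^ 2)) atTop (𝓝 l)) (j : ℕ) (x y : ℝ) :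
    Tendsto (fun n => chiSqCondCDF j (r n) (2 * x + b n) (2 * y + b n)) atTop
      (𝓝 (stdPhi (√l / 2 + (y - x) / √l))) := by
  have hpos (z : ℝ) : ∀ᶠ n in atTop, 0 < 2 * z + b n :=
    (tendsto_atTop_add_const_left _ (2 * z) hb).eventually_gt_atTop 0
  set f : ℕ → ℝ → ℝ := fun n => (Ioi (-b n / 2)).indicator
    (fun t => 2 * condDensity j (r n) (2 * x + b n) (2 * t + b n)) with hf
  have hcont (n : ℕ) : Continuous fun t => 2 * condDensity j (r n) (2 * x + b n) (2 * t + b n) :=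
    ((continuous_curry_left (continuous_condDensity j (r n)) (2 * x + b n)).comp
      (by fun_prop : Continuous fun t : ℝ => 2 * t + b n)).const_mul 2
  have hint (n : ℕ) (h1 : 0 < 1 - r n ^ 2) (h2 : 0 < 2 * x + b n) : ∫ t, f n t = 1 := by
    rw [hf]
    simp only
    rw [integral_indicator measurableSet_Ioi, setIntegral_Ioi_comp_affine,
      show 2 * (-b n / 2) + b n = 0 by ring, integral_condDensity j h1 h2.le]
  rw [← integral_Iic_stdphi_affine hl0 x y]
  have hmain := tendsto_setIntegral_of_density (f := f)
    (g := fun t => 1 / √l * stdphi (√l / 2 + (t - x) / √l)) ?_ ?_ ?_ ?_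
    (integrable_stdphi_affine hl0 x) (integral_stdphi_affine hl0 x) ?_ (Iic y)
  · refine hmain.congr' ?_
    filter_upwards [hpos y] with n hn
    rw [hf]
    simp only
    rw [setIntegral_indicator measurableSet_Ioi, inter_comm, Ioi_inter_Iic,
      ← intervalIntegral.integral_of_le (by linarith), intervalIntegral.integral_const_mul,
      intervalIntegral.mul_integral_comp_mul_add, chiSqCondCDF,
      show 2 * (-b n / 2) + b n = 0 by ring]
  · filter_upwards [hr, hpos x] with n h1 h2
    exact Integrable.of_integral_ne_zero (by rw [hint n h1 h2]; exact one_ne_zero)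
  · exact fun n => (hcont n).measurable.indicator measurableSet_Ioi
  · exact fun n t => indicator_nonneg
      (fun t _ => mul_nonneg zero_le_two (condDensity_nonneg j _ _ _)) t
  · filter_upwards [hr, hpos x] with n h1 h2
    exact hint n h1 h2
  · intro t
    refine (tendsto_condDensity hb hl0 hr hl j x t).congr' ?_
    filter_upwards [hpos t] with n hn
    rw [hf]
    simp only
    rw [indicator_of_mem (show t ∈ Ioi (-b n / 2) by simp only [mem_Ioi]; linarith)]

/-! ### Tails of the marginal laws -/

lemma normT_eq (m n : ℕ) (x : ℝ) : normT m n x = 2 * x + normB m n := rfl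

lemma tendsto_log_natCast : Tendsto (fun n : ℕ => Real.log n) atTop atTop :=
  Real.tendsto_log_atTop.comp tendsto_natCast_atTop_atTop

lemma tendsto_normB_div (m : ℕ) :
    Tendsto (fun n : ℕ => normB m n / (2 * Real.log n)) atTop (𝓝 1) := by
  have h1 : Tendsto (fun n : ℕ => Real.log (Real.log n) / Real.log n) atTop (𝓝 0) :=
    (Real.isLittleO_log_id_atTop.tendsto_div_nhds_zero).comp tendsto_log_natCast
  have h2 : Tendsto (fun n : ℕ => Real.log (Real.Gamma ((m : ℝ) / 2)) / Real.log n) atTop (𝓝 0) :=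
    tendsto_const_nhds.div_atTop tendsto_log_natCast
  have h3 := ((h1.const_mul (((m : ℝ) - 2) / 2)).const_add 1).sub h2
  rw [mul_zero, add_zero, sub_zero] at h3
  refine h3.congr' ?_
  filter_upwards [tendsto_log_natCast.eventually_gt_atTop 0] with n hn
  unfold normB
  field_simp

lemma tendsto_normB (m : ℕ) : Tendsto (fun n : ℕ => normB m n) atTop atTop := by
  have h := (tendsto_normB_div m).pos_mul_atTop one_pos
    (tendsto_log_natCast.const_mul_atTop (zero_lt_two : (0 : ℝ) < 2))
  refine h.congr' ?_
  filter_upwards [tendsto_log_natCast.eventually_gt_atTop 0] with n hn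
  field_simp

/-- The centring constants are chosen so that `n g(t_n(x))`, for the chi-square density `g`, is
`e^{-x}` up to a factor tending to `1`. -/
lemma mul_chiSqDensity_normT (j : ℕ) {n : ℕ} (hn : 2 ≤ n) (x : ℝ) :
    (n : ℝ) * (2 * chiSqDensity j (normT (j + 2) n x)) =
      Real.exp (-x) * (√(normT (j + 2) n x) / √(2 * Real.log n)) ^ j := by
  have hn0 : (0 : ℝ) < n := by positivity
  have hL : 0 < Real.log n := Real.log_pos (by exact_mod_cast hn)
  have hΓ : 0 < Real.Gamma (((j : ℝ) + 2) / 2) := Real.Gamma_pos_of_pos (by positivity)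
  have hexp : Real.exp (-normT (j + 2) n x / 2) =
      Real.exp (-x) * Real.Gamma (((j : ℝ) + 2) / 2) / (n * √(Real.log n) ^ j) := by
    have e1 : √(Real.log n) ^ j = Real.exp (j * (Real.log (Real.log n) / 2)) := by
      rw [Real.exp_nat_mul, Real.exp_half, Real.exp_log hL]
    have e2 : -normT (j + 2) n x / 2 = -x + Real.log (Real.Gamma (((j : ℝ) + 2) / 2)) -
        (Real.log n + j * (Real.log (Real.log n) / 2)) := by
      rw [normT_eq, normB]
      push_cast
      ring
    rw [e1, e2, Real.exp_sub, Real.exp_add, Real.exp_add, Real.exp_log hΓ, Real.exp_log hn0]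
  have hpow : (2 : ℝ) ^ ((j : ℝ) / 2) = √2 ^ j := by
    rw [Real.sqrt_eq_rpow, ← Real.rpow_natCast, ← Real.rpow_mul zero_le_two]
    congr 1
    ring
  rw [chiSqDensity, hexp, gaussMoment_succ, hpow, Real.sqrt_mul zero_le_two, div_pow, mul_pow]
  field_simp

lemma tendsto_mul_chiSqDensity (j : ℕ) (x : ℝ) :
    Tendsto (fun n : ℕ => (n : ℝ) * (2 * chiSqDensity j (normT (j + 2) n x))) atTop
      (𝓝 (Real.exp (-x))) := by
  have h1 : Tendsto (fun n : ℕ => 2 * x / (2 * Real.log n) + normB (j + 2) n / (2 * Real.log n))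
      atTop (𝓝 (0 + 1)) :=
    (tendsto_const_nhds.div_atTop (tendsto_log_natCast.const_mul_atTop zero_lt_two)).add
      (tendsto_normB_div (j + 2))
  have h2 := ((h1.sqrt.pow j).const_mul (Real.exp (-x)))
  rw [zero_add, Real.sqrt_one, one_pow, mul_one] at h2
  refine h2.congr' ?_
  filter_upwards [eventually_ge_atTop 2] with n hn
  have hL : 0 < Real.log n := Real.log_pos (by exact_mod_cast hn)
  rw [mul_chiSqDensity_normT j hn, ← Real.sqrt_div' _ (by positivity), normT_eq, add_div]

lemma exists_mul_chiSqDensity_le (j : ℕ) (y : ℝ) :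
    ∃ C : ℝ, ∀ᶠ n : ℕ in atTop, ∀ t, y < t →
      (n : ℝ) * (2 * chiSqDensity j (normT (j + 2) n t)) ≤ C * Real.exp (-(1 / 2) * t) := by
  -- The factor besides `e^{-t}` is at most `(|t| + 2) ^ j ≤ 2 ^ j j! e^{(|t| + 2) / 2}`, and
  -- `|t| ≤ t + 2 |y|` for `t > y`.
  refine ⟨2 ^ j * j.factorial * Real.exp (1 + |y|), ?_⟩
  filter_upwards [eventually_ge_atTop 2, tendsto_log_natCast.eventually_ge_atTop 1,
    (tendsto_normB_div (j + 2)).eventually_le_const one_lt_two] with n hn hL hb t ht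
  have hL0 : 0 < 2 * Real.log n := by linarith
  rw [mul_chiSqDensity_normT j hn, ← Real.sqrt_div' _ hL0.le, normT_eq, add_div]
  have h1 : 2 * t / (2 * Real.log n) ≤ |t| := by
    rw [mul_div_mul_left _ _ two_ne_zero]
    refine (le_abs_self _).trans ?_
    rw [abs_div, abs_of_pos (by linarith : 0 < Real.log n)]
    exact div_le_self (abs_nonneg t) hL
  have h2 : √(2 * t / (2 * Real.log n) + normB (j + 2) n / (2 * Real.log n)) ≤ |t| + 2 := by
    have h0 := abs_nonneg t
    rw [Real.sqrt_le_left (by positivity)]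
    nlinarith
  have h3 : (|t| + 2) ^ j ≤ 2 ^ j * j.factorial * Real.exp ((|t| + 2) / 2) := by
    have h := Real.pow_div_factorial_le_exp ((|t| + 2) / 2) (by positivity) j
    rw [div_le_iff₀ (by positivity), div_pow, div_le_iff₀ (by positivity)] at h
    linarith
  have h4 : |t| ≤ t + 2 * |y| := by
    rcases abs_cases t with h | h <;> rcases abs_cases y with h' | h' <;> linarith
  calc Real.exp (-t) * √(2 * t / (2 * Real.log n) + normB (j + 2) n / (2 * Real.log n)) ^ j
      ≤ Real.exp (-t) * (2 ^ j * j.factorial * Real.exp ((|t| + 2) / 2)) := by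
        gcongr
        exact (pow_le_pow_left₀ (Real.sqrt_nonneg _) h2 j).trans h3
    _ = 2 ^ j * j.factorial * Real.exp (-t + (|t| + 2) / 2) := by rw [Real.exp_add]; ring
    _ ≤ 2 ^ j * j.factorial * Real.exp (1 + |y| + -(1 / 2) * t) := by
        refine mul_le_mul_of_nonneg_left (Real.exp_le_exp.2 ?_) (by positivity)
        linarith
    _ = _ := by rw [Real.exp_add]; ring

/-- Dominated convergence for integrals against the rescaled chi-square density. -/
lemma tendsto_integral_mul_chiSqDensity (j : ℕ) (y : ℝ) {W : ℕ → ℝ → ℝ} {V : ℝ → ℝ}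
    (hWm : ∀ n, Measurable (W n)) (hW : ∀ᶠ n in atTop, ∀ t, y < t → |W n t| ≤ 1)
    (hlim : ∀ t, y < t → Tendsto (fun n => W n t) atTop (𝓝 (V t))) :
    Tendsto (fun n : ℕ => ∫ t in Ioi y,
      (n : ℝ) * (2 * chiSqDensity j (normT (j + 2) n t)) * W n t) atTop
      (𝓝 (∫ t in Ioi y, Real.exp (-t) * V t)) := by
  obtain ⟨C, hC⟩ := exists_mul_chiSqDensity_le j y
  refine tendsto_integral_filter_of_dominated_convergence
    (fun t => C * Real.exp (-(1 / 2) * t)) ?_ ?_ ?_ ?_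
  · refine Eventually.of_forall fun n => ?_
    have h1 := (continuous_chiSqDensity j).measurable
    have h2 := hWm n
    simp only [normT_eq]
    exact Measurable.aestronglyMeasurable (by fun_prop)
  · filter_upwards [hC, hW] with n h1 h2
    filter_upwards [ae_restrict_mem measurableSet_Ioi] with t ht
    have h3 := chiSqDensity_nonneg j (normT (j + 2) n t)
    have h4 : 0 ≤ (n : ℝ) * (2 * chiSqDensity j (normT (j + 2) n t)) := by positivity
    rw [norm_mul, Real.norm_of_nonneg h4, Real.norm_eq_abs]
    exact (mul_le_of_le_one_right h4 (h2 t ht)).trans (h1 t ht)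
  · exact (exp_neg_integrableOn_Ioi y (by norm_num)).const_mul C
  · filter_upwards [ae_restrict_mem measurableSet_Ioi] with t ht
    exact (tendsto_mul_chiSqDensity j t).mul (hlim t ht)

/-! ### The joint distribution function -/

section Law

variable {Ω : Type*} [MeasurableSpace Ω] {P : Measure Ω} {j : ℕ} {r : ℝ}
  {X : Fin (j + 2) → Ω → ℝ × ℝ}

lemma aemeasurable_chiSq (hlaw : ∀ i, HasLaw (X i) (gaussianPairLaw r) P) :
    AEMeasurable (fun ω => (chiSqFst X ω, chiSqSnd X ω)) P := by
  have h := fun i => (hlaw i).aemeasurable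
  unfold chiSqFst chiSqSnd
  refine AEMeasurable.prodMk ?_ ?_
  · exact Finset.aemeasurable_fun_sum _ fun i _ => (h i).fst.pow_const 2
  · exact Finset.aemeasurable_fun_sum _ fun i _ => (h i).snd.pow_const 2

lemma jointCDF_eq_map (hlaw : ∀ i, HasLaw (X i) (gaussianPairLaw r) P) (u v : ℝ) :
    jointCDF P (chiSqFst X) (chiSqSnd X) u v =
      (P.map (fun ω => (chiSqFst X ω, chiSqSnd X ω))).real (Iic u ×ˢ Iic v) := by
  rw [measureReal_def, Measure.map_apply_of_aemeasurable (aemeasurable_chiSq hlaw)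
    (measurableSet_Iic.prod measurableSet_Iic)]
  rfl

lemma jointCDF_of_neg {u v : ℝ} (h : u < 0 ∨ v < 0) :
    jointCDF P (chiSqFst X) (chiSqSnd X) u v = 0 := by
  have : {ω | chiSqFst X ω ≤ u ∧ chiSqSnd X ω ≤ v} = ∅ := by
    rw [eq_empty_iff_forall_notMem]
    rintro ω ⟨h1, h2⟩
    have h3 : 0 ≤ chiSqFst X ω := Finset.sum_nonneg fun i _ => sq_nonneg _
    have h4 : 0 ≤ chiSqSnd X ω := Finset.sum_nonneg fun i _ => sq_nonneg _
    rcases h with h | h <;> linarith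
  simp [jointCDF, this]

variable [IsProbabilityMeasure P]

lemma map_chiSq_prod (hr : 0 < 1 - r ^ 2) (hlaw : ∀ i, HasLaw (X i) (gaussianPairLaw r) P)
    (hindep : iIndepFun X P) {s t : Set ℝ} (hs : MeasurableSet s) (ht : MeasurableSet t) :
    P.map (fun ω => (chiSqFst X ω, chiSqSnd X ω)) (s ×ˢ t) =
      ∫⁻ u in s ∩ Ioi 0, ∫⁻ v in t ∩ Ioi 0, ENNReal.ofReal (jointDensity j r u v) := by
  have hst := hs.prod ht
  rw [← lintegral_indicator_one hst, lintegral_map' (by fun_prop) (aemeasurable_chiSq hlaw),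
    lintegral_chiSq hr hlaw hindep _ (measurable_one.indicator hst), ← setLIntegral_indicator hs]
  refine lintegral_congr fun u => ?_
  by_cases hu : u ∈ s
  · rw [indicator_of_mem hu, ← setLIntegral_indicator ht]
    refine lintegral_congr fun v => ?_
    by_cases hv : v ∈ t
    · rw [indicator_of_mem hv, indicator_of_mem (show (u, v) ∈ s ×ˢ t from ⟨hu, hv⟩)]
      simp
    · rw [indicator_of_notMem hv, indicator_of_notMem (fun h => hv h.2), zero_mul]
  · rw [indicator_of_notMem hu]
    simp [hu]

lemma lintegral_Ioc_ofReal {f : ℝ → ℝ} (hf : Continuous f) (hf0 : ∀ x, 0 ≤ f x) {v : ℝ}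
    (hv : 0 ≤ v) :
    ∫⁻ w in Iic v ∩ Ioi 0, ENNReal.ofReal (f w) = ENNReal.ofReal (∫ w in (0 : ℝ)..v, f w) := by
  rw [inter_comm, Ioi_inter_Iic, intervalIntegral.integral_of_le hv,
    ofReal_integral_eq_lintegral_ofReal
      ((hf.integrableOn_Icc).mono_set Ioc_subset_Icc_self) (Eventually.of_forall hf0)]

lemma jointCDF_eq_rectInt (hr : 0 < 1 - r ^ 2)
    (hlaw : ∀ i, HasLaw (X i) (gaussianPairLaw r) P) (hindep : iIndepFun X P) {u v : ℝ}
    (hu : 0 ≤ u) (hv : 0 ≤ v) :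
    jointCDF P (chiSqFst X) (chiSqSnd X) u v = rectInt (jointDensity j r) u v := by
  have hc := continuous_jointDensity j r
  rw [jointCDF_eq_map hlaw, measureReal_def,
    map_chiSq_prod hr hlaw hindep measurableSet_Iic measurableSet_Iic]
  simp_rw [fun t => lintegral_Ioc_ofReal (continuous_curry_left hc t)
    (jointDensity_nonneg j r t) hv]
  rw [lintegral_Ioc_ofReal (continuous_curry_right (f := fun t v => ∫ w in (0 : ℝ)..v,
      jointDensity j r t w) (continuous_integral_snd hc) v)
    (fun t => intervalIntegral.integral_nonneg hv fun w _ => jointDensity_nonneg j r t w) hu]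
  exact ENNReal.toReal_ofReal (rectInt_nonneg (jointDensity_nonneg j r) hu hv)

lemma integral_jointDensity_snd (j : ℕ) (r u v : ℝ) :
    ∫ w in (0 : ℝ)..v, jointDensity j r u w = chiSqDensity j u * chiSqCondCDF j r u v := by
  simp only [jointDensity, intervalIntegral.integral_const_mul, chiSqCondCDF]

lemma integral_jointDensity_fst (j : ℕ) {r : ℝ} (hr : 0 < 1 - r ^ 2) (u v : ℝ) :
    ∫ t in (0 : ℝ)..u, jointDensity j r t v = chiSqDensity j v * chiSqCondCDF j r v u := by
  simp_rw [fun t => jointDensity_comm j hr t v]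
  exact integral_jointDensity_snd j r v u

/-- The exceedance probability splits into `{ζ₁ > u}` and `{ζ₁ ≤ u, ζ₂ > v}`; the symmetry of the
joint density allows conditioning on `ζ₂` in the second event. -/
lemma one_sub_jointCDF (hr : 0 < 1 - r ^ 2)
    (hlaw : ∀ i, HasLaw (X i) (gaussianPairLaw r) P) (hindep : iIndepFun X P) {u v : ℝ}
    (hu : 0 ≤ u) (hv : 0 ≤ v) :
    1 - jointCDF P (chiSqFst X) (chiSqSnd X) u v =
      (∫ t in Ioi u, chiSqDensity j t) +
        ∫ w in Ioi v, chiSqDensity j w * chiSqCondCDF j r w u := by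
  have hc := continuous_jointDensity j r
  have hmeas := aemeasurable_chiSq hlaw
  have hprob : IsProbabilityMeasure (P.map (fun ω => (chiSqFst X ω, chiSqSnd X ω))) :=
    Measure.isProbabilityMeasure_map hmeas
  set μ := P.map (fun ω => (chiSqFst X ω, chiSqSnd X ω)) with hμ
  have hIoi {a : ℝ} (ha : 0 ≤ a) : Ioi a ∩ Ioi 0 = Ioi a := by
    rw [Ioi_inter_Ioi, max_eq_left ha]
  have hK0 : ∀ w ∈ Ioi v, 0 ≤ chiSqDensity j w * chiSqCondCDF j r w u := fun w _ =>
    mul_nonneg (chiSqDensity_nonneg j w) (chiSqCondCDF_nonneg j r w hu)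
  have hKc : Continuous fun w => chiSqDensity j w * chiSqCondCDF j r w u :=
    (continuous_chiSqDensity j).mul (continuous_curry_right (continuous_chiSqCondCDF j r) u)
  have h1 : μ.real (Ioi u ×ˢ univ) = ∫ t in Ioi u, chiSqDensity j t := by
    rw [measureReal_def, map_chiSq_prod hr hlaw hindep measurableSet_Ioi MeasurableSet.univ,
      hIoi hu, univ_inter, integral_eq_lintegral_of_nonneg_ae
        (Eventually.of_forall fun t => chiSqDensity_nonneg j t)
        (continuous_chiSqDensity j).aestronglyMeasurable]
    congr 1
    refine setLIntegral_congr_fun measurableSet_Ioi (fun t ht => ?_)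
    have ht0 : 0 ≤ t := hu.trans (le_of_lt ht)
    have hm : Measurable fun w => ENNReal.ofReal (condDensity j r t w) :=
      (continuous_curry_left (continuous_condDensity j r) t).measurable.ennreal_ofReal
    simp_rw [jointDensity, ENNReal.ofReal_mul (chiSqDensity_nonneg j t)]
    rw [lintegral_const_mul _ hm, lintegral_condDensity j hr ht0, mul_one]
  have h2 : μ.real (Iic u ×ˢ Ioi v) =
      ∫ w in Ioi v, chiSqDensity j w * chiSqCondCDF j r w u := by
    rw [measureReal_def, map_chiSq_prod hr hlaw hindep measurableSet_Iic measurableSet_Ioi,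
      hIoi hv, lintegral_lintegral_swap hc.measurable.ennreal_ofReal.aemeasurable,
      integral_eq_lintegral_of_nonneg_ae (by
        filter_upwards [ae_restrict_mem measurableSet_Ioi] with w hw
        exact hK0 w hw) hKc.aestronglyMeasurable]
    congr 1
    refine setLIntegral_congr_fun measurableSet_Ioi (fun w hw => ?_)
    rw [lintegral_Ioc_ofReal (continuous_curry_right hc w) (fun t => jointDensity_nonneg j r t w)
      hu, integral_jointDensity_fst j hr]
  have hcompl : (Iic u ×ˢ Iic v : Set (ℝ × ℝ))ᶜ = Ioi u ×ˢ univ ∪ Iic u ×ˢ Ioi v := by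
    ext ⟨a, c⟩
    simp only [mem_compl_iff, mem_prod, mem_Iic, mem_union, mem_Ioi, mem_univ, and_true,
      not_and_or, not_le]
    constructor
    · rintro (h | h)
      · exact Or.inl h
      · rcases lt_or_ge u a with h' | h'
        · exact Or.inl h'
        · exact Or.inr ⟨h', h⟩
    · rintro (h | h)
      · exact Or.inl h
      · exact Or.inr h.2
  have hdisj : Disjoint (Ioi u ×ˢ univ : Set (ℝ × ℝ)) (Iic u ×ˢ Ioi v) := by
    rw [Set.disjoint_left]
    rintro ⟨a, c⟩ h h'
    exact not_le_of_gt (mem_Ioi.1 h.1) (mem_Iic.1 h'.1)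
  rw [jointCDF_eq_map hlaw, ← probReal_compl_eq_one_sub (measurableSet_Iic.prod measurableSet_Iic),
    ← hμ, hcompl, measureReal_union hdisj (measurableSet_Iic.prod measurableSet_Ioi), h1, h2]

end Law

/-! ### Convergence of the densities -/

section Limit

variable {j : ℕ} {r : ℕ → ℝ} {l : ℝ}

lemma eventually_normT_pos (m : ℕ) (x : ℝ) : ∀ᶠ n in atTop, 0 < normT m n x :=
  (tendsto_atTop_add_const_left _ (2 * x) (tendsto_normB m)).eventually_gt_atTop 0

lemma tendsto_exceedance (hl0 : 0 < l) (hr : ∀ᶠ n in atTop, 0 < 1 - r n ^ 2)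
    (hl : Tendsto (fun n => normB (j + 2) n * (1 - r n ^ 2)) atTop (𝓝 l)) (x y : ℝ) :
    Tendsto (fun n : ℕ => (n : ℝ) * ((∫ t in Ioi (normT (j + 2) n x), chiSqDensity j t) +
        ∫ w in Ioi (normT (j + 2) n y),
          chiSqDensity j w * chiSqCondCDF j (r n) w (normT (j + 2) n x))) atTop
      (𝓝 (Real.exp (-x) * stdPhi (√l / 2 + (y - x) / √l) +
        Real.exp (-y) * stdPhi (√l / 2 + (x - y) / √l))) := by
  have hb := tendsto_normB (j + 2)
  have h1 := tendsto_integral_mul_chiSqDensity j x (W := fun _ _ => 1) (V := fun _ => 1)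
    (fun _ => measurable_const) (Eventually.of_forall fun _ _ _ => by simp)
    (fun _ _ => tendsto_const_nhds)
  have h2 := tendsto_integral_mul_chiSqDensity j y
    (W := fun n t => chiSqCondCDF j (r n) (normT (j + 2) n t) (normT (j + 2) n x))
    (V := fun t => stdPhi (√l / 2 + (x - t) / √l))
    (fun n => ((continuous_curry_right (continuous_chiSqCondCDF j (r n)) _).comp
      (by simp only [normT_eq]; fun_prop : Continuous fun t => normT (j + 2) n t)).measurable)
    (by
      filter_upwards [hr, eventually_normT_pos (j + 2) x, eventually_normT_pos (j + 2) y]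
        with n hn hx hy t ht
      have ht0 : 0 ≤ normT (j + 2) n t := by
        rw [normT_eq] at hy ⊢
        linarith
      rw [abs_of_nonneg (chiSqCondCDF_nonneg j _ _ hx.le)]
      exact chiSqCondCDF_le_one j hn ht0 hx.le)
    (fun t _ => tendsto_chiSqCondCDF hb hl0 hr hl j t x)
  have h3 := h1.add h2
  simp only [mul_one] at h3
  rw [integral_exp_neg_Ioi, integral_Ioi_exp_mul_stdPhi hl0 x y] at h3
  have hval : Real.exp (-x) + (Real.exp (-x) * stdPhi (√l / 2 + (y - x) / √l) +
      Real.exp (-y) * stdPhi (√l / 2 + (x - y) / √l) - Real.exp (-x)) =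
      Real.exp (-x) * stdPhi (√l / 2 + (y - x) / √l) +
        Real.exp (-y) * stdPhi (√l / 2 + (x - y) / √l) := by ring
  rw [hval] at h3
  refine h3.congr fun n => ?_
  rw [mul_add, normT_eq, normT_eq, ← setIntegral_Ioi_comp_affine, ← setIntegral_Ioi_comp_affine,
    ← integral_const_mul, ← integral_const_mul]
  congr 1
  refine integral_congr_ae (Eventually.of_forall fun t => ?_)
  simp only [normT_eq]
  ring

/-- Three ingredients of the density of the maximum converge separately: the rescaled joint
density, the two rescaled partial derivatives of the distribution function, and its powers.
The hypothesis `hG` expresses the exceedance probability through the conditional law. -/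
lemma tendsto_powDensity (hl0 : 0 < l) (hr : ∀ᶠ n in atTop, 0 < 1 - r n ^ 2)
    (hl : Tendsto (fun n => normB (j + 2) n * (1 - r n ^ 2)) atTop (𝓝 l)) (x y : ℝ)
    (hG : ∀ᶠ n in atTop,
      1 - rectInt (jointDensity j (r n)) (normT (j + 2) n x) (normT (j + 2) n y) =
        (∫ t in Ioi (normT (j + 2) n x), chiSqDensity j t) +
        ∫ w in Ioi (normT (j + 2) n y),
          chiSqDensity j w * chiSqCondCDF j (r n) w (normT (j + 2) n x)) :
    Tendsto (fun n => 4 * powDensity (jointDensity j (r n)) (n - 2) (normT (j + 2) n x)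
      (normT (j + 2) n y)) atTop (𝓝 (huslerReissPDF l x y)) := by
  have hb := tendsto_normB (j + 2)
  set G : ℕ → ℝ := fun n =>
    rectInt (jointDensity j (r n)) (normT (j + 2) n x) (normT (j + 2) n y) with hGdef
  have hexc : Tendsto (fun n : ℕ => (n : ℝ) * (G n - 1)) atTop
      (𝓝 (-(Real.exp (-x) * stdPhi (√l / 2 + (y - x) / √l) +
        Real.exp (-y) * stdPhi (√l / 2 + (x - y) / √l)))) := by
    refine (tendsto_exceedance hl0 hr hl x y).neg.congr' ?_
    filter_upwards [hG] with n hn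
    rw [← hn]
    ring
  have hpow : Tendsto (fun n => G n ^ n) atTop (𝓝 (huslerReissCDF l x y)) := by
    have h := Real.tendsto_one_add_pow_exp_of_tendsto hexc
    have hval : -(Real.exp (-x) * stdPhi (√l / 2 + (y - x) / √l) +
        Real.exp (-y) * stdPhi (√l / 2 + (x - y) / √l)) =
        -Real.exp (-x) * stdPhi (√l / 2 + (y - x) / √l) -
          Real.exp (-y) * stdPhi (√l / 2 + (x - y) / √l) := by ring
    rw [hval] at h
    simpa [huslerReissCDF] using h
  have hG1 : Tendsto G atTop (𝓝 1) := by
    have h := (hexc.div_atTop tendsto_natCast_atTop_atTop).add_const 1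
    rw [zero_add] at h
    refine h.congr' ?_
    filter_upwards [eventually_gt_atTop 0] with n hn
    have : (n : ℝ) ≠ 0 := by positivity
    field_simp
    ring
  have hgx := tendsto_mul_chiSqDensity j x
  have hgy := tendsto_mul_chiSqDensity j y
  have hk := tendsto_condDensity hb hl0 hr hl j x y
  have hKx := tendsto_chiSqCondCDF hb hl0 hr hl j x y
  have hKy := tendsto_chiSqCondCDF hb hl0 hr hl j y x
  have hn1 : Tendsto (fun n : ℕ => 1 - 1 / (n : ℝ)) atTop (𝓝 (1 - 0)) :=
    tendsto_one_div_atTop_nhds_zero_nat.const_sub 1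
  have hall := (((hpow.div hG1 one_ne_zero).mul (hgx.mul hk)).add
    (((hpow.div (hG1.pow 2) (by norm_num)).mul hn1).mul
      ((hgx.mul hKx).mul (hgy.mul hKy))))
  have hval : huslerReissCDF l x y / 1 *
      (Real.exp (-x) * (1 / √l * stdphi (√l / 2 + (y - x) / √l))) +
      huslerReissCDF l x y / 1 ^ 2 * (1 - 0) *
        (Real.exp (-x) * stdPhi (√l / 2 + (y - x) / √l) *
          (Real.exp (-y) * stdPhi (√l / 2 + (x - y) / √l))) = huslerReissPDF l x y := by
    unfold huslerReissPDF
    ring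
  rw [hval] at hall
  refine hall.congr' ?_
  filter_upwards [hr, hG1.eventually_const_lt zero_lt_one, eventually_ge_atTop 2] with n hrn hpos hn
  obtain ⟨k, rfl⟩ := Nat.exists_eq_add_of_le' hn
  simp only [normT_eq] at hGdef ⊢
  have hGk : rectInt (jointDensity j (r (k + 2))) (2 * x + normB (j + 2) (k + 2))
      (2 * y + normB (j + 2) (k + 2)) = G (k + 2) := by rw [hGdef]
  rw [Nat.add_sub_cancel, powDensity, integral_jointDensity_fst j hrn, integral_jointDensity_snd,
    jointDensity, hGk]
  have hk : ((k : ℝ) + 2) ≠ 0 := by positivity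
  push_cast
  simp only [Pi.div_apply]
  field_simp
  ring

end Limit

theorem mainTheorem4 (m : ℕ) (hm : 2 ≤ m) (ρ : ℕ → ℝ)
    (hρ : ∀ n, 2 ≤ n → ρ n ∈ Ioo (-1 : ℝ) 1 ∧ ρ n ≠ 0)
    {Ω : ℕ → Type*} [∀ n, MeasurableSpace (Ω n)] (P : ∀ n, Measure (Ω n))
    [∀ n, IsProbabilityMeasure (P n)]
    (X : ∀ n, Fin m → Ω n → ℝ × ℝ)
    (hlaw : ∀ n, 2 ≤ n → ∀ i, HasLaw (X n i) (gaussianPairLaw (ρ n)) (P n))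
    (hindep : ∀ n, 2 ≤ n → iIndepFun (X n) (P n))
    (H : ℕ → ℝ → ℝ → ℝ)
    (hH : ∀ n, H n = jointCDF (P n) (chiSqFst (X n)) (chiSqSnd (X n)))
    (l : ℝ) (hl : 0 < l)
    (hHR : Tendsto (fun n : ℕ => 2 * (normB m n / normA n) * (1 - ρ n ^ 2)) atTop (𝓝 l)) :
    (∀ n, 2 ≤ n → ∃ f : ℝ → ℝ → ℝ,
      IsPDFOf (fun x y => H n (normT m n x) (normT m n y) ^ n) f ∧
      ContinuousOn (fun z : ℝ × ℝ => f z.1 z.2) (posRegion m n)) ∧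
    (∀ h : ℕ → ℝ → ℝ → ℝ,
      (∀ n, 2 ≤ n →
        IsPDFOf (fun x y => H n (normT m n x) (normT m n y) ^ n) (h n) ∧
        ContinuousOn (fun z : ℝ × ℝ => h n z.1 z.2) (posRegion m n)) →
      ∀ x y : ℝ, Tendsto (fun n => h n x y) atTop (𝓝 (huslerReissPDF l x y))) := by
  obtain ⟨j, rfl⟩ := Nat.exists_eq_add_of_le' hm
  have hr (n : ℕ) (hn : 2 ≤ n) : 0 < 1 - ρ n ^ 2 := by
    have h := (hρ n hn).1
    nlinarith [h.1, h.2]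
  have hpdf (n : ℕ) (hn : 2 ≤ n) :
      IsPDFOf (fun x y => H n (normT (j + 2) n x) (normT (j + 2) n y) ^ n)
        (scaledPowDensity (jointDensity j (ρ n)) (n - 2) (normB (j + 2) n)) := by
    have h := isPDFOf_scaledPowDensity (continuous_jointDensity j (ρ n))
      (jointDensity_nonneg j (ρ n)) (n - 2) (normB (j + 2) n) (H := H n)
      (fun u v hu hv => by
        rw [hH n]
        exact jointCDF_eq_rectInt (hr n hn) (hlaw n hn) (hindep n hn) hu hv)
      (fun u v huv => by
        rw [hH n]
        exact jointCDF_of_neg huv)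
    rwa [Nat.sub_add_cancel hn] at h
  have hEq (n : ℕ) {z : ℝ × ℝ} (hz : z ∈ posRegion (j + 2) n) :
      scaledPowDensity (jointDensity j (ρ n)) (n - 2) (normB (j + 2) n) z.1 z.2 =
        4 * powDensity (jointDensity j (ρ n)) (n - 2) (normT (j + 2) n z.1)
          (normT (j + 2) n z.2) :=
    if_pos hz
  have hcont (n : ℕ) : ContinuousOn (fun z : ℝ × ℝ =>
      scaledPowDensity (jointDensity j (ρ n)) (n - 2) (normB (j + 2) n) z.1 z.2)
      (posRegion (j + 2) n) :=
    ((continuous_comp_affine (continuous_powDensity (continuous_jointDensity j (ρ n)) (n - 2))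
      (normB (j + 2) n)).const_mul 4).continuousOn.congr fun z hz => hEq n hz
  refine ⟨fun n hn => ⟨_, hpdf n hn, hcont n⟩, fun h hh x y => ?_⟩
  have hHR' : Tendsto (fun n => normB (j + 2) n * (1 - ρ n ^ 2)) atTop (𝓝 l) := by
    refine hHR.congr fun n => ?_
    simp only [normA]
    ring
  have hlim := tendsto_powDensity hl ((eventually_ge_atTop 2).mono hr) hHR' x y (by
    filter_upwards [eventually_ge_atTop 2, eventually_normT_pos (j + 2) x,
      eventually_normT_pos (j + 2) y] with n hn hx hy
    rw [← jointCDF_eq_rectInt (hr n hn) (hlaw n hn) (hindep n hn) hx.le hy.le]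
    exact one_sub_jointCDF (hr n hn) (hlaw n hn) (hindep n hn) hx.le hy.le)
  refine hlim.congr' ?_
  filter_upwards [eventually_ge_atTop 2, eventually_normT_pos (j + 2) x,
    eventually_normT_pos (j + 2) y] with n hn hx hy
  have hopen : IsOpen (posRegion (j + 2) n) := by
    have hc : Continuous (normT (j + 2) n) := by
      simp only [funext (normT_eq (j + 2) n)]
      fun_prop
    exact (isOpen_lt continuous_const (hc.comp continuous_fst)).inter
      (isOpen_lt continuous_const (hc.comp continuous_snd))
  have hz : (x, y) ∈ posRegion (j + 2) n := ⟨hx, hy⟩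
  rw [← hEq n hz]
  exact (hpdf n hn).eqOn (hh n hn).1 hopen (hcont n) (hh n hn).2 hz
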